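/- Let $\mathbb{R}_m$ (also written $Cl_m$) be the real Clifford algebra generated by the standard basis $e_1,\dots,e_m$ of $\mathbb{R}^m$ with $e_ie_j+e_je_i=-2\delta_{ij}$, normed by $|\sum_A x_Ae_A|=(\sum_A x_A^2)^{1/2}$. Identify $\mathbb{R}^{m+1}$ with the paravectors $x=x_0+\underline{x}$, $\underline{x}=\sum_{j=1}^m x_je_j$, and put $\bar x=x_0-\underline{x}$, $\mathrm{Re}\,x=x_0$. Let $\mathbb{S}=\{I=\sum_{j=1}^m x_je_j:\ |I|=1\}$, and for $I\in\mathbb{S}$ let $\mathbb{C}_I=\{u+Iv:\ u,v\in\mathbb{R}\}$, with area element $dV_I$. Let $D\subset\mathbb{C}$ be open and invariant under complex conjugation, $\Omega_D=\{u+Jv:\ u+iv\in D,\ J\in\mathbb{S}\}$ and $\Omega_I=\Omega_D\cap\mathbb{C}_I$. Assume that $\Omega_D$ is bounded and does not meet the real line. Let $$S^{-1}(q,x)=-(q^2-2\,\mathrm{Re}(x)\,q+|x|^2)^{-1}(q-\bar x),\qquad T_{\Omega_I}f(q)=-\frac1{2\pi}\int_{\Omega_I}S^{-1}(q,x)f(x)\,dV_I(x),$$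 $$G=\frac{\partial}{\partial x_0}+\frac{\underline{x}}{|\underline{x}|^2}\sum_{j=1}^m x_j\frac{\partial}{\partial x_j}.$$ A function $f:\Omega_D\to Cl_m$ is a (left) slice function if there are $F_1,F_2:D\to Cl_m$ with $F_1(\bar z)=F_1(z)$, $F_2(\bar z)=-F_2(z)$ and $f(u+Jv)=F_1(z)+JF_2(z)$ for all $z=u+iv\in D$ and $J\in\mathbb{S}$. Let $f\in C^1(\overline{\Omega_D})$ with values in $Cl_m$, that is, $f$ is differentiable on $\Omega_D$, and $f$ and its derivative extend continuously to $\overline{\Omega_D}$. Let $I\in\mathbb{S}$. For $q\in\Omega_D$ write $\zeta=|\underline{q}|$, $q=q_0+I_q\zeta$, $q_{\pm I}=q_0\pm I\zeta$, $\alpha=\frac{1-I_qI}{2}$, $\beta=\frac{1+I_qI}{2}$; let $\partial_\zeta$ denote differentiation in $\zeta$ with $q_0$ and $I_q$ fixed; and let $\mathrm{p.v.}\!\int_{\Omega_I}$ be the limit as $\varepsilon\to0^+$ of the integrals over $\Omega_I\setminus(B(q_I,\varepsilon)\cup B(q_{-I},\varepsilon))$. Then for every $q\in\Omega_D$ the integral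 defining $T_{\Omega_I}f(q)$ converges absolutely, the following derivatives and principal values exist, and $$2\pi\,\partial_{q_0}T_{\Omega_I}f(q)=-\,\mathrm{p.v.}\!\int_{\Omega_I}\frac{\partial S^{-1}(q,x)}{\partial q_0}f(x)\,dV_I(x)+\pi\big[\alpha f(q_I)+\beta f(q_{-I})\big],$$ $$2\pi\,\partial_{q_i}T_{\Omega_I}f(q)=-\,\mathrm{p.v.}\!\int_{\Omega_I}\frac{\partial S^{-1}(q,x)}{\partial q_i}f(x)\,dV_I(x)-\frac{q_i}{|\underline{q}|}\,\pi\big[\alpha If(q_I)-\beta If(q_{-I})\big],\qquad i=1,\dots,m,$$ $$2\pi\,\partial_{\zeta}T_{\Omega_I}f(q)=-\,\mathrm{p.v.}\!\int_{\Omega_I}\frac{\partial S^{-1}(q,x)}{\partial \zeta}f(x)\,dV_I(x)-\pi\big[\alpha If(q_I)-\beta If(q_{-I})\big],$$ $$G_qT_{\Omega_I}f(q)=\alpha f(q_I)+\beta f(q_{-I}).$$ If $f$ is moreover a slice function on $\Omega_D$, then $G_qT_{\Omega_I}f(q)=f(q)$ for all $q\in\Omega_D$. -/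

import Mathlib

open Topology

noncomputable section

namespace SliceClifford

/-- The `m`-dimensional Euclidean space of 1-vectors. -/
abbrev Vec (m : ℕ) : Type := EuclideanSpace ℝ (Fin m)

/-- The quadratic form `v ↦ -|v|²` on `ℝ^m`. -/
def negSq (m : ℕ) : QuadraticForm ℝ (Vec m) :=
  -(LinearMap.BilinMap.toQuadraticMap (innerₗ (Vec m)))

/-- The real Clifford algebra `Cl_m`, generated by `ℝ^m` with `v² = -|v|²`,
equivalently `e_i e_j + e_j e_i = -2 δ_ij`. -/
abbrev Cl (m : ℕ) : Type := CliffordAlgebra (negSq m)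

/-- The inclusion of the 1-vectors into `Cl_m`. -/
def vecCl {m : ℕ} (v : Vec m) : Cl m := CliffordAlgebra.ι (negSq m) v

/-- The standard basis `e_A` of `Cl_m`, `A ⊆ {1, …, m}`. -/
def stdBasis (m : ℕ) : Module.Basis (Finset (Fin m)) ℝ (Cl m) :=
  (EuclideanSpace.basisFun (Fin m) ℝ).toBasis.ExteriorAlgebra.map
    (CliffordAlgebra.equivExterior (negSq m)).symm

/-- The coordinates `(x_A)_A` of `x = ∑ x_A e_A`. -/
def coords (m : ℕ) : Cl m ≃ₗ[ℝ] EuclideanSpace ℝ (Finset (Fin m)) :=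
  (stdBasis m).equivFun.trans (WithLp.linearEquiv 2 ℝ (Finset (Fin m) → ℝ)).symm

/-- The norm `|x| = (∑ x_A²)^(1/2)` on `Cl_m`. -/
instance instNormedAddCommGroupCl (m : ℕ) : NormedAddCommGroup (Cl m) :=
  NormedAddCommGroup.induced (Cl m) (EuclideanSpace ℝ (Finset (Fin m))) (coords m)
    (coords m).injective

instance instNormedSpaceCl (m : ℕ) : NormedSpace ℝ (Cl m) :=
  NormedSpace.induced ℝ (Cl m) (EuclideanSpace ℝ (Finset (Fin m))) (coords m)

theorem vecCl_mul_self {m : ℕ} (v : Vec m) :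
    vecCl v * vecCl v = algebraMap ℝ (Cl m) (-‖v‖ ^ 2) := by
  rw [vecCl, CliffordAlgebra.ι_sq_scalar]
  congr 1
  simp [negSq]

theorem contractLeft_prod_eq_zero {m : ℕ} (d : Module.Dual ℝ (Vec m)) (l : List (Vec m))
    (h : ∀ v ∈ l, d v = 0) :
    CliffordAlgebra.contractLeft (Q := (0 : QuadraticForm ℝ (Vec m))) d
      ((l.map (CliffordAlgebra.ι (0 : QuadraticForm ℝ (Vec m)))).prod) = 0 := by
  induction l with
  | nil => simp
  | cons a l ih =>
    rw [List.map_cons, List.prod_cons, CliffordAlgebra.contractLeft_ι_mul,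
      ih (fun v hv => h v (List.mem_cons_of_mem _ hv)), h a (by simp)]
    simp

theorem equivExterior_prod {m : ℕ} (l : List (Vec m))
    (h : l.Pairwise (fun v w => inner ℝ v w = 0)) :
    CliffordAlgebra.equivExterior (negSq m) ((l.map vecCl).prod) =
      (l.map (CliffordAlgebra.ι (0 : QuadraticForm ℝ (Vec m)))).prod := by
  induction l with
  | nil =>
    rw [CliffordAlgebra.equivExterior, CliffordAlgebra.changeFormEquiv_apply]
    exact CliffordAlgebra.changeForm_one _
  | cons a l ih =>
    rw [List.pairwise_cons] at h
    have := ih h.2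
    rw [CliffordAlgebra.equivExterior, CliffordAlgebra.changeFormEquiv_apply] at this ⊢
    rw [List.map_cons, List.prod_cons, vecCl, CliffordAlgebra.changeForm_ι_mul, this,
      List.map_cons, List.prod_cons, contractLeft_prod_eq_zero, sub_zero]
    intro v hv
    have h1 := h.1 v hv
    have h2 : inner ℝ v a = 0 := by rw [real_inner_comm]; exact h1
    simp [QuadraticMap.associated_apply, negSq, inner_add_right, h1, h2]

/-- `e_A` is the product of the `e_i`, `i ∈ A`, in increasing order. -/
theorem stdBasis_apply (m : ℕ) (A : Finset (Fin m)) :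
    stdBasis m A =
      ((A.sort (· ≤ ·)).map (fun i => vecCl (EuclideanSpace.single i (1 : ℝ)))).prod := by
  have h : (A.sort (· ≤ ·)).map (fun i => vecCl (EuclideanSpace.single i (1 : ℝ))) =
      ((A.sort (· ≤ ·)).map (fun i => EuclideanSpace.single i (1 : ℝ))).map vecCl := by
    simp
  rw [h, stdBasis, Module.Basis.map_apply, LinearEquiv.symm_apply_eq, equivExterior_prod,
    ExteriorAlgebra.basis_apply_ofCard _ (rfl : A.card = A.card)]
  · refine (ExteriorAlgebra.ιMulti_apply (R := ℝ) _).trans ?_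
    rw [List.ofFn_eq_map, List.map_map, ← Finset.listMap_orderEmbOfFin_finRange A rfl, List.map_map]
    simp [Function.comp_def, Set.powersetCard.ofFinEmbEquiv_symm_apply]
  · rw [List.pairwise_map]
    refine (Finset.sort_nodup A (· ≤ ·)).imp ?_
    intro i j hij
    simp [EuclideanSpace.inner_single_left, hij]

theorem norm_sq_eq {m : ℕ} (x : Cl m) : ‖x‖ ^ 2 = ∑ A, ((stdBasis m).repr x A) ^ 2 := by
  change ‖coords m x‖ ^ 2 = _
  rw [EuclideanSpace.norm_sq_eq]
  simp [coords]

instance instFiniteDimensionalCl (m : ℕ) : FiniteDimensional ℝ (Cl m) :=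
  (stdBasis m).finiteDimensional_of_finite

/-- The space `ℝ^(m+1)` of paravectors `x = (x_0, x_1, …, x_m)`. -/
abbrev Para (m : ℕ) : Type := EuclideanSpace ℝ (Fin (m + 1))

/-- The 1-vector part `(x_1, …, x_m)` of a paravector. -/
def vec {m : ℕ} (x : Para m) : Vec m := WithLp.toLp 2 (fun i => x i.succ)

/-- The paravector `x_0 + x_1 e_1 + … + x_m e_m` as an element of `Cl_m`. -/
def paraCl {m : ℕ} (x : Para m) : Cl m := algebraMap ℝ (Cl m) (x 0) + vecCl (vec x)

/-- `ℝ^(m+1)` without the real line. -/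
def nonreal (m : ℕ) : Set (Para m) := {x | vec x ≠ 0}

/-- The direction `I_x = vec x / |vec x|` of a nonreal paravector. -/
def unitVec {m : ℕ} (x : Para m) : Vec m := ‖vec x‖⁻¹ • vec x

/-- The paravector `u + J v`, for `z = u + i v`. For `|J| = 1` the map `z ↦ u + J v` is an isometry
of `ℂ` onto the plane `ℂ_J`. -/
def slicePt {m : ℕ} (J : Vec m) (z : ℂ) : Para m :=
  WithLp.toLp 2 (Fin.cons z.re (fun i => z.im * J i))

/-- The axially symmetric set `Ω_D`, the union over all unit vectors `J` of
`{u + J v : u + i v ∈ D}`. -/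
def axialSet (m : ℕ) (D : Set ℂ) : Set (Para m) :=
  ⋃ J ∈ Metric.sphere (0 : Vec m) 1, slicePt J '' D

/-- The set `{z : u + I v ∈ Ω}`, that is `Ω ∩ ℂ_I` in the coordinate `z = u + i v` of `ℂ_I`. -/
def planeSet {m : ℕ} (Ω : Set (Para m)) (I : Vec m) : Set ℂ := slicePt I ⁻¹' Ω

/-- The coordinate `q_0 + i |vec q|` of a paravector in its own plane. -/
def planeCoord {m : ℕ} (q : Para m) : ℂ := ⟨q 0, ‖vec q‖⟩

/-- The Cauchy kernel `S⁻¹(q, x) = -(q² - 2 Re(x) q + |x|²)⁻¹ (q - conj x)`. On `Cl_m`, `star` is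
the Clifford conjugation, and `Ring.inverse` is the inverse of an invertible element. -/
def cauchyKernel {m : ℕ} (q x : Para m) : Cl m :=
  -(Ring.inverse (paraCl q ^ 2 - (2 * x 0) • paraCl q + algebraMap ℝ (Cl m) (‖x‖ ^ 2)) *
    (paraCl q - star (paraCl x)))

/-- The partial derivative `∂S⁻¹(q, x)/∂q_j`, `j = 0, …, m`. -/
def kernelPartial {m : ℕ} (j : Fin (m + 1)) (q x : Para m) : Cl m :=
  lineDeriv ℝ (fun p => cauchyKernel p x) q (EuclideanSpace.single j 1)

/-- The derivative of `h` at `q` in `ζ = |vec q|`, where `q = q_0 + I_q ζ`, for fixed `q_0` and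
`I_q`. -/
def HasRadialDeriv {m : ℕ} (h : Para m → Cl m) (h' : Cl m) (q : Para m) : Prop :=
  HasDerivAt (fun ζ : ℝ => h (slicePt (unitVec q) ⟨q 0, ζ⟩)) h' ‖vec q‖

/-- The derivative `∂S⁻¹(q, x)/∂ζ`, `ζ = |vec q|`, for fixed `q_0` and `I_q`. -/
def kernelRadial {m : ℕ} (q x : Para m) : Cl m :=
  deriv (fun ζ : ℝ => cauchyKernel (slicePt (unitVec q) ⟨q 0, ζ⟩) x) ‖vec q‖

/-- The slice Teodorescu transform
`T_{Ω_I} f(q) = -(1/2π) ∫_{Ω_I} S⁻¹(q, x) f(x) dV_I(x)`. -/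
def sliceT {m : ℕ} (Ω : Set (Para m)) (I : Vec m) (f : Para m → Cl m) (q : Para m) : Cl m :=
  -(1 / (2 * Real.pi)) •
    ∫ z in planeSet Ω I, cauchyKernel q (slicePt I z) * f (slicePt I z)

/-- The slice Cauchy-Riemann operator
`G = ∂/∂x_0 + (vec x / |vec x|²) ∑_{j=1}^m x_j ∂/∂x_j`. -/
def opG {m : ℕ} (h : Para m → Cl m) (x : Para m) : Cl m :=
  lineDeriv ℝ h x (EuclideanSpace.single 0 1) +
    (‖vec x‖ ^ 2)⁻¹ •
      (vecCl (vec x) * ∑ j : Fin m, x j.succ • lineDeriv ℝ h x (EuclideanSpace.single j.succ 1))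

/-- `α = (1 - I_q I)/2`. -/
def alpha {m : ℕ} (I : Vec m) (q : Para m) : Cl m :=
  (1 / 2 : ℝ) • (1 - vecCl (unitVec q) * vecCl I)

/-- `β = (1 + I_q I)/2`. -/
def beta {m : ℕ} (I : Vec m) (q : Para m) : Cl m :=
  (1 / 2 : ℝ) • (1 + vecCl (unitVec q) * vecCl I)

/-- `P` is the Cauchy principal value of the integral over `U` of `g`, with singularities at
`c` and at its complex conjugate. -/
def HasPV {m : ℕ} (U : Set ℂ) (c : ℂ) (g : ℂ → Cl m) (P : Cl m) : Prop :=
  (∀ ε : ℝ, 0 < ε → MeasureTheory.IntegrableOn g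
    (U \ (Metric.ball c ε ∪ Metric.ball (star c) ε))) ∧
  Filter.Tendsto
    (fun ε : ℝ => ∫ z in U \ (Metric.ball c ε ∪ Metric.ball (star c) ε), g z)
    (𝓝[>] 0) (𝓝 P)

/-- `f ∈ C¹(closure Ω)`, for an open set `Ω`: on `Ω`, `f` is differentiable, and `f` and its
derivative extend continuously to the closure of `Ω`. Only the values of `f` on `Ω` matter. -/
def IsC1Closure {m : ℕ} (Ω : Set (Para m)) (f : Para m → Cl m) : Prop :=
  ∃ (g : Para m → Cl m) (g' : Para m → Para m →L[ℝ] Cl m),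
    ContinuousOn g (closure Ω) ∧ ContinuousOn g' (closure Ω) ∧
    ∀ x ∈ Ω, f x = g x ∧ HasFDerivAt f (g' x) x

/-- `f` is a (left) slice function on `Ω_D`: there is a stem function `F = F₁ + i F₂` on `D`,
`F(conj z) = conj F(z)`, with `f(u + J v) = F₁(z) + J F₂(z)` for all unit vectors `J` and all
`z = u + i v ∈ D`. -/
def IsSlice {m : ℕ} (D : Set ℂ) (f : Para m → Cl m) : Prop :=
  ∃ F₁ F₂ : ℂ → Cl m,
    (∀ z ∈ D, F₁ (star z) = F₁ z ∧ F₂ (star z) = -F₂ z) ∧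
    ∀ J ∈ Metric.sphere (0 : Vec m) 1, ∀ z ∈ D,
      f (slicePt J z) = F₁ z + vecCl J * F₂ z

end SliceClifford

end

open SliceClifford

/-!
In the coordinates of `ℂ_I`, the kernel `S⁻¹(q, x)` is the slice extension `α k(z) + β k(z̄)` of the
Cauchy kernel `k(c) = (x - c)⁻¹`, where `z = q₀ + i |q|`. So `T f` is the slice extension of the
planar Teodorescu transform of the restriction of `f` to `Ω_I`. Since `I_q α = α I` and
`I_q β = -β I`, the operator `G` acts on a slice extension as `∂ᵤ + I ∂ᵥ` on the plane, which
inverts the Teodorescu transform.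

On the plane one differentiates the Cauchy transform of `φ` at `c`. If `φ(z) = O(z - c)`, then
factoring `z - c` out of the density reduces differentiability at `c` to continuity of the Cauchy
transform of `φ(z) / (z - c)`, whose density is bounded near `c`. In general one first subtracts a
multiple of the Gaussian `exp(-|z - c|²)`: its Cauchy transform is differentiated by moving the
derivative to the Gaussian, and the principal value of its Beurling transform vanishes because
`z⁻²` changes sign under the rotation `z ↦ i z`.
-/

noncomputable section

namespace SliceClifford

open MeasureTheory Metric Filter Asymptotics

section LocalBounds

variable {E : Type*} [NormedAddCommGroup E] {f : ℂ → E} {c : ℂ}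

theorem tendsto_sub_self_nhds (c : ℂ) : Tendsto (fun z => z - c) (𝓝 c) (𝓝 0) :=
  (continuous_sub_right c).tendsto' _ _ (sub_self c)

theorem isBigO_one_of_isBigO_sub (hO : f =O[𝓝 c] fun z => z - c) :
    f =O[𝓝 c] fun _ => (1 : ℝ) :=
  hO.trans ((tendsto_sub_self_nhds c).isBigO_one ℝ)

theorem isBigO_one_of_sub_isBigO (hO : (fun z => f z - f c) =O[𝓝 c] fun z => z - c) :
    f =O[𝓝 c] fun _ => (1 : ℝ) := by
  simpa using (isBigO_one_of_isBigO_sub hO).add (isBigO_const_const (f c) one_ne_zero _)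

theorem eventually_isBigO_one (hb : f =O[𝓝 c] fun _ => (1 : ℝ)) :
    ∀ᶠ b in 𝓝 c, f =O[𝓝 b] fun _ => (1 : ℝ) := by
  obtain ⟨C, hC⟩ := hb.bound
  filter_upwards [eventually_eventually_nhds.2 hC] with b hCb
  exact .of_bound C hCb

end LocalBounds

section CauchyTransform

variable {E : Type*} [NormedAddCommGroup E] [NormedSpace ℂ E]

/-- The planar Cauchy transform. -/
def cauchyTransform (f : ℂ → E) (c : ℂ) : E := ∫ z, (z - c)⁻¹ • f z

theorem integrableOn_norm_rpow_neg {s : ℝ} (hs : s < 2) (r : ℝ) :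
    IntegrableOn (fun z : ℂ => ‖z‖ ^ (-s)) (ball 0 r) := by
  refine integrableOn_ball_of_norm_le_rpow (α := s) (C := 1) ?_ ?_ (.of_forall fun z => ?_) ?_
  · simp
  · simpa using hs
  · simp [abs_of_nonneg (Real.rpow_nonneg (norm_nonneg z) _)]
  · exact (measurable_norm.pow_const _).aestronglyMeasurable

theorem norm_sub_rpow_neg_mul_le {s : ℝ} (hs : 0 ≤ s) {g : ℂ → ℝ} (hg0 : ∀ z, 0 ≤ g z)
    {c : ℂ} {r M : ℝ} (hr : 0 < r) (hM : ∀ z ∈ ball c r, g z ≤ M) (z : ℂ) :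
    ‖z - c‖ ^ (-s) * g z ≤
      M * (ball 0 r).indicator (fun w : ℂ => ‖w‖ ^ (-s)) (z - c) + r ^ (-s) * g z := by
  by_cases hz : z - c ∈ ball (0 : ℂ) r
  · rw [Set.indicator_of_mem hz]
    have := hM z (by simpa [dist_eq_norm] using hz)
    have := mul_le_mul_of_nonneg_left this (Real.rpow_nonneg (norm_nonneg (z - c)) (-s))
    have := mul_nonneg (Real.rpow_nonneg hr.le (-s)) (hg0 z)
    linarith
  · rw [Set.indicator_of_notMem hz, mul_zero, zero_add]
    have hrz : r ≤ ‖z - c‖ := by simpa using hz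
    exact mul_le_mul_of_nonneg_right (Real.rpow_le_rpow_of_nonpos hr hrz (by linarith)) (hg0 z)

section Weighted

variable {s : ℝ} {g : ℂ → ℝ} {c : ℂ} {r M : ℝ}

theorem integrable_indicator_norm_sub_rpow_neg (hs : s < 2) (c : ℂ) (r : ℝ) :
    Integrable fun z => (ball 0 r).indicator (fun w : ℂ => ‖w‖ ^ (-s)) (z - c) :=
  ((integrableOn_norm_rpow_neg hs r).integrable_indicator measurableSet_ball).comp_sub_right c

theorem integrable_norm_sub_rpow_neg_mul (hs0 : 0 ≤ s) (hs : s < 2) (hg : Integrable g)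
    (hg0 : ∀ z, 0 ≤ g z) (hr : 0 < r) (hM : ∀ z ∈ ball c r, g z ≤ M) :
    Integrable fun z => ‖z - c‖ ^ (-s) * g z := by
  refine (((integrable_indicator_norm_sub_rpow_neg hs c r).const_mul M).add
    (hg.const_mul (r ^ (-s)))).mono' ?_ (.of_forall fun z => ?_)
  · exact ((measurable_norm.comp (measurable_sub_const c)).pow_const _).aestronglyMeasurable.mul
      hg.aestronglyMeasurable
  · rw [Real.norm_of_nonneg (mul_nonneg (Real.rpow_nonneg (norm_nonneg _) _) (hg0 z))]
    exact norm_sub_rpow_neg_mul_le hs0 hg0 hr hM z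

theorem integral_norm_sub_rpow_neg_mul_le (hs0 : 0 ≤ s) (hs : s < 2) (hg : Integrable g)
    (hg0 : ∀ z, 0 ≤ g z) (hr : 0 < r) (hM : ∀ z ∈ ball c r, g z ≤ M) :
    ∫ z, ‖z - c‖ ^ (-s) * g z ≤
      M * (∫ z in ball (0 : ℂ) r, ‖z‖ ^ (-s)) + r ^ (-s) * ∫ z, g z := by
  have hI := integrable_indicator_norm_sub_rpow_neg hs c r
  calc ∫ z, ‖z - c‖ ^ (-s) * g z
      ≤ ∫ z, (M * (ball 0 r).indicator (fun w : ℂ => ‖w‖ ^ (-s)) (z - c) + r ^ (-s) * g z) :=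
        integral_mono (integrable_norm_sub_rpow_neg_mul hs0 hs hg hg0 hr hM)
          ((hI.const_mul M).add (hg.const_mul _)) (norm_sub_rpow_neg_mul_le hs0 hg0 hr hM)
    _ = _ := by
        rw [integral_add (hI.const_mul M) (hg.const_mul _), integral_const_mul, integral_const_mul,
          integral_sub_right_eq_self (fun z => (ball 0 r).indicator (fun w : ℂ => ‖w‖ ^ (-s)) z),
          integral_indicator measurableSet_ball]

end Weighted

variable {f : ℂ → E} {c : ℂ}

theorem integrable_inv_sub_smul (hf : Integrable f) (hb : f =O[𝓝 c] fun _ => (1 : ℝ)) :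
    Integrable fun z => (z - c)⁻¹ • f z := by
  obtain ⟨M, hM⟩ := hb.bound
  obtain ⟨r, hr, hball⟩ := Metric.eventually_nhds_iff_ball.1 hM
  have := integrable_norm_sub_rpow_neg_mul (s := 1) zero_le_one one_lt_two hf.norm
    (fun z => norm_nonneg (f z)) hr (M := M) (c := c) (fun z hz => by simpa using hball z hz)
  refine this.mono' ?_ (.of_forall fun z => ?_)
  · exact ((measurable_sub_const c).inv).aestronglyMeasurable.smul hf.aestronglyMeasurable
  · rw [norm_smul, norm_inv, Real.rpow_neg_one]

theorem mul_inv_mul_inv_le_sqrt_mul {a b d : ℝ} (ha : 0 < a) (hb : 0 < b) (hd : 0 ≤ d)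
    (hdab : d ≤ a + b) :
    d * (a⁻¹ * b⁻¹) ≤ √d * (a ^ (-(3 / 2) : ℝ) + b ^ (-(3 / 2) : ℝ)) := by
  have rpow_eq {x : ℝ} (hx : 0 < x) : x ^ (-(3 / 2) : ℝ) = (√x ^ 3)⁻¹ := by
    rw [Real.rpow_neg hx.le, Real.sqrt_eq_rpow, ← Real.rpow_natCast, ← Real.rpow_mul hx.le]
    norm_num
  rw [rpow_eq ha, rpow_eq hb]
  obtain ⟨A, hA, rfl⟩ : ∃ A, 0 < A ∧ A ^ 2 = a := ⟨√a, Real.sqrt_pos.2 ha, Real.sq_sqrt ha.le⟩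
  obtain ⟨B, hB, rfl⟩ : ∃ B, 0 < B ∧ B ^ 2 = b := ⟨√b, Real.sqrt_pos.2 hb, Real.sq_sqrt hb.le⟩
  obtain ⟨δ, hδ, rfl⟩ : ∃ δ, 0 ≤ δ ∧ δ ^ 2 = d := ⟨√d, Real.sqrt_nonneg d, Real.sq_sqrt hd⟩
  rw [Real.sqrt_sq hA.le, Real.sqrt_sq hB.le, Real.sqrt_sq hδ]
  have hδAB : δ ≤ A + B := by nlinarith [mul_pos hA hB]
  have cubes : (A + B) * (A * B) ≤ A ^ 3 + B ^ 3 := by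
    nlinarith [mul_nonneg (add_pos hA hB).le (sq_nonneg (A - B))]
  calc δ ^ 2 * ((A ^ 2)⁻¹ * (B ^ 2)⁻¹) = δ * (δ * (A * B) / (A ^ 3 * B ^ 3)) := by field_simp
    _ ≤ δ * ((A ^ 3 + B ^ 3) / (A ^ 3 * B ^ 3)) := by
        gcongr
        exact (mul_le_mul_of_nonneg_right hδAB (mul_pos hA hB).le).trans cubes
    _ = δ * ((A ^ 3)⁻¹ + (B ^ 3)⁻¹) := by field_simp; ring

theorem norm_inv_sub_smul_sub_le {z c c₀ : ℂ} (hz : z ≠ c) (hz₀ : z ≠ c₀) (v : E) :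
    ‖(z - c)⁻¹ • v - (z - c₀)⁻¹ • v‖ ≤
      √‖c - c₀‖ * (‖z - c‖ ^ (-(3 / 2) : ℝ) * ‖v‖ + ‖z - c₀‖ ^ (-(3 / 2) : ℝ) * ‖v‖) := by
  have hc : z - c ≠ 0 := sub_ne_zero.2 hz
  have hc₀ : z - c₀ ≠ 0 := sub_ne_zero.2 hz₀
  have htri : ‖c - c₀‖ ≤ ‖z - c‖ + ‖z - c₀‖ := by
    simpa [dist_eq_norm] using dist_triangle_left c c₀ z
  calc ‖(z - c)⁻¹ • v - (z - c₀)⁻¹ • v‖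
      = ‖c - c₀‖ * (‖z - c‖⁻¹ * ‖z - c₀‖⁻¹) * ‖v‖ := by
        rw [← sub_smul, inv_sub_inv hc hc₀, norm_smul, norm_div, norm_mul, sub_sub_sub_cancel_left,
          div_eq_mul_inv, mul_inv]
    _ ≤ _ := by
        rw [← add_mul, ← mul_assoc √‖c - c₀‖]
        exact mul_le_mul_of_nonneg_right (mul_inv_mul_inv_le_sqrt_mul (norm_pos_iff.2 hc)
          (norm_pos_iff.2 hc₀) (norm_nonneg _) htri) (norm_nonneg v)

theorem norm_cauchyTransform_sub_le (hf : Integrable f) {c₀ : ℂ} {r M : ℝ} (hr : 0 < r)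
    (hM : ∀ z ∈ ball c₀ (r + r), ‖f z‖ ≤ M) (hc : c ∈ ball c₀ r) :
    ‖cauchyTransform f c - cauchyTransform f c₀‖ ≤ √‖c - c₀‖ *
      (2 * (M * (∫ z in ball (0 : ℂ) r, ‖z‖ ^ (-(3 / 2) : ℝ)) +
        r ^ (-(3 / 2) : ℝ) * ∫ z, ‖f z‖)) := by
  have hball {b : ℂ} (hb : b ∈ ball c₀ r) : ∀ z ∈ ball b r, ‖f z‖ ≤ M := fun z hz =>
    hM z ((dist_triangle z b c₀).trans_lt (add_lt_add hz hb))
  have hbdd {b : ℂ} (hb : b ∈ ball c₀ r) : f =O[𝓝 b] fun _ => (1 : ℝ) :=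
    .of_bound M (by
      filter_upwards [ball_mem_nhds b hr] with z hz using by simpa using hball hb z hz)
  have hint {b : ℂ} (hb : b ∈ ball c₀ r) : Integrable fun z => ‖z - b‖ ^ (-(3 / 2) : ℝ) * ‖f z‖ :=
    integrable_norm_sub_rpow_neg_mul (by norm_num) (by norm_num) hf.norm
      (fun z => norm_nonneg (f z)) hr (hball hb)
  have hle {b : ℂ} (hb : b ∈ ball c₀ r) := integral_norm_sub_rpow_neg_mul_le (s := 3 / 2)
    (by norm_num) (by norm_num) hf.norm (fun z => norm_nonneg (f z)) hr (hball hb)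
  have hc₀ : c₀ ∈ ball c₀ r := mem_ball_self hr
  calc ‖cauchyTransform f c - cauchyTransform f c₀‖
      = ‖∫ z, ((z - c)⁻¹ • f z - (z - c₀)⁻¹ • f z)‖ := by
        rw [integral_sub (integrable_inv_sub_smul hf (hbdd hc))
          (integrable_inv_sub_smul hf (hbdd hc₀)), cauchyTransform, cauchyTransform]
    _ ≤ ∫ z, √‖c - c₀‖ *
          (‖z - c‖ ^ (-(3 / 2) : ℝ) * ‖f z‖ + ‖z - c₀‖ ^ (-(3 / 2) : ℝ) * ‖f z‖) := by
        refine norm_integral_le_of_norm_le (((hint hc).add (hint hc₀)).const_mul _) ?_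
        filter_upwards [Measure.ae_ne volume c, Measure.ae_ne volume c₀] with z hz hz₀
        exact norm_inv_sub_smul_sub_le hz hz₀ (f z)
    _ ≤ _ := by
        rw [integral_const_mul, integral_add (hint hc) (hint hc₀), two_mul]
        gcongr
        exacts [hle hc, hle hc₀]

theorem continuousAt_cauchyTransform (hf : Integrable f) (hb : f =O[𝓝 c] fun _ => (1 : ℝ)) :
    ContinuousAt (cauchyTransform f) c := by
  obtain ⟨M, hM⟩ := hb.bound
  obtain ⟨r, hr, hball⟩ := Metric.eventually_nhds_iff_ball.1 hM
  have hlim : Tendsto (fun b => √‖b - c‖ * (2 * (M * (∫ z in ball (0 : ℂ) (r / 2),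
      ‖z‖ ^ (-(3 / 2) : ℝ)) + (r / 2) ^ (-(3 / 2) : ℝ) * ∫ z, ‖f z‖))) (𝓝 c) (𝓝 0) := by
    refine Continuous.tendsto' (by fun_prop) _ _ (by simp)
  refine tendsto_iff_norm_sub_tendsto_zero.2
    (squeeze_zero' (.of_forall fun _ => norm_nonneg _) ?_ hlim)
  filter_upwards [ball_mem_nhds c (half_pos hr)] with b hb
  refine norm_cauchyTransform_sub_le hf (half_pos hr) (fun z hz => ?_) hb
  simpa using hball z (by rwa [add_halves] at hz)

theorem isBigO_inv_sub_smul (hO : f =O[𝓝 c] fun z => z - c) :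
    (fun z => (z - c)⁻¹ • f z) =O[𝓝 c] fun _ => (1 : ℝ) := by
  refine ((isBigO_refl (fun z => (z - c)⁻¹) _).smul hO).trans (.of_bound 1 (.of_forall fun z => ?_))
  simpa using inv_mul_le_one

theorem integrable_inv_sub_smul_of_isBigO (hf : Integrable f) (hO : f =O[𝓝 c] fun z => z - c) :
    Integrable fun z => (z - c)⁻¹ • f z :=
  integrable_inv_sub_smul hf (isBigO_one_of_isBigO_sub hO)

theorem cauchyTransform_eq_add (hf : Integrable f) (hO : f =O[𝓝 c] fun z => z - c) :
    ∀ᶠ b in 𝓝 c, cauchyTransform f b =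
      cauchyTransform f c + (b - c) • cauchyTransform (fun z => (z - c)⁻¹ • f z) b := by
  have hbdd := isBigO_inv_sub_smul hO
  have hint : Integrable fun z => (z - c)⁻¹ • f z := integrable_inv_sub_smul_of_isBigO hf hO
  filter_upwards [eventually_isBigO_one hbdd] with b hb
  have hintb : Integrable fun z => (b - c) • (z - b)⁻¹ • (z - c)⁻¹ • f z :=
    (integrable_inv_sub_smul hint hb).smul (b - c)
  rw [cauchyTransform, cauchyTransform, cauchyTransform, ← integral_smul,
    ← integral_add hint hintb]
  refine integral_congr_ae ?_
  filter_upwards [Measure.ae_ne volume b, Measure.ae_ne volume c] with z hzb hzc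
  have := sub_ne_zero.2 hzb
  have := sub_ne_zero.2 hzc
  simp only [smul_smul, ← add_smul]
  congr 1
  field_simp
  ring

theorem hasDerivAt_cauchyTransform (hf : Integrable f) (hO : f =O[𝓝 c] fun z => z - c) :
    HasDerivAt (cauchyTransform f) (∫ z, ((z - c) ^ 2)⁻¹ • f z) c := by
  have hbdd := isBigO_inv_sub_smul hO
  have hint : Integrable fun z => (z - c)⁻¹ • f z := integrable_inv_sub_smul_of_isBigO hf hO
  have hlim := (continuousAt_cauchyTransform hint hbdd).tendsto.mono_left
    (nhdsWithin_le_nhds (s := {c}ᶜ))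
  have hV : cauchyTransform (fun z => (z - c)⁻¹ • f z) c = ∫ z, ((z - c) ^ 2)⁻¹ • f z := by
    simp only [cauchyTransform, smul_smul, sq, mul_inv]
  rw [hasDerivAt_iff_tendsto_slope, ← hV]
  refine hlim.congr' ?_
  filter_upwards [(cauchyTransform_eq_add hf hO).filter_mono nhdsWithin_le_nhds,
    self_mem_nhdsWithin] with b hb hbc
  rw [slope_def_module, hb, add_sub_cancel_left, inv_smul_smul₀ (sub_ne_zero.2 hbc)]

theorem integrable_inv_sub_sq_smul (hf : Integrable f) (hO : f =O[𝓝 c] fun z => z - c) :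
    Integrable fun z => ((z - c) ^ 2)⁻¹ • f z := by
  simpa only [smul_smul, sq, mul_inv] using integrable_inv_sub_smul
    (integrable_inv_sub_smul_of_isBigO hf hO) (isBigO_inv_sub_smul hO)

end CauchyTransform

section RotationInvariance

variable {E : Type*} [NormedAddCommGroup E] [NormedSpace ℝ E]

theorem integral_eq_zero_of_comp_I_mul_eq_neg {g : ℂ → E} (hg : ∀ z, g (Complex.I * z) = -g z) :
    ∫ z, g z = 0 := by
  have hrot : ∫ z, g (Complex.I * z) = ∫ z, g z :=
    (rotation ⟨Complex.I, by simp [Submonoid.unitSphere]⟩).measurePreserving.integral_comp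
      (rotation _).toHomeomorph.measurableEmbedding g
  rw [funext hg, integral_neg, neg_eq_iff_add_eq_zero, ← two_smul ℝ, smul_eq_zero] at hrot
  exact hrot.resolve_left two_ne_zero

end RotationInvariance

/-- The Gaussian `exp (-|z|²)`. -/
def planarGaussian (z : ℂ) : ℂ := Real.exp (-‖z‖ ^ 2)

theorem planarGaussian_zero : planarGaussian 0 = 1 := by simp [planarGaussian]

theorem planarGaussian_I_mul (z : ℂ) : planarGaussian (Complex.I * z) = planarGaussian z := by
  simp [planarGaussian]

theorem integral_exp_neg_mul_norm_sq {b : ℝ} (hb : 0 < b) :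
    ∫ z : ℂ, Real.exp (-b * ‖z‖ ^ 2) = Real.pi / b := by
  simpa using GaussianFourier.integral_rexp_neg_mul_sq_norm (V := ℂ) hb

theorem integrable_exp_neg_mul_norm_sq {b : ℝ} (hb : 0 < b) :
    Integrable fun z : ℂ => Real.exp (-b * ‖z‖ ^ 2) :=
  .of_integral_ne_zero (by rw [integral_exp_neg_mul_norm_sq hb]; positivity)

theorem integrable_planarGaussian : Integrable planarGaussian := by
  simpa only [planarGaussian, neg_one_mul] using!
    (integrable_exp_neg_mul_norm_sq one_pos).ofReal (𝕜 := ℂ)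

theorem integral_planarGaussian : ∫ z, planarGaussian z = Real.pi := by
  have := integral_exp_neg_mul_norm_sq one_pos
  simp only [neg_mul, one_mul, div_one] at this
  simp only [planarGaussian]
  rw [integral_complex_ofReal, this]

theorem setIntegral_inv_sub_sq_mul_planarGaussian (c : ℂ) (ε : ℝ) :
    ∫ z in (ball c ε)ᶜ, ((z - c) ^ 2)⁻¹ * planarGaussian (z - c) = 0 := by
  rw [← integral_indicator measurableSet_ball.compl, ← integral_add_right_eq_self _ c]
  refine integral_eq_zero_of_comp_I_mul_eq_neg fun z => ?_
  classical
  have hmem : Complex.I * z + c ∈ (ball c ε)ᶜ ↔ z + c ∈ (ball c ε)ᶜ := by simp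
  simp only [Set.indicator_apply, hmem, add_sub_cancel_right, planarGaussian_I_mul, mul_pow,
    Complex.I_sq, inv_neg, neg_mul]
  split_ifs <;> simp

/-- The derivative of the Gaussian. -/
def fderivPlanarGaussian (z : ℂ) : ℂ →L[ℝ] ℂ :=
  Complex.ofRealCLM ∘L (-(2 * Real.exp (-‖z‖ ^ 2)) • innerSL ℝ z)

theorem hasFDerivAt_planarGaussian (z : ℂ) :
    HasFDerivAt planarGaussian (fderivPlanarGaussian z) z := by
  have h := (hasFDerivAt_id (𝕜 := ℝ) z).norm_sq.neg.exp
  refine (Complex.ofRealCLM.hasFDerivAt.comp z h).congr_fderiv ?_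
  ext v
  change ((Real.exp (-‖z‖ ^ 2) * -(2 • inner ℝ z v) : ℝ) : ℂ) =
    ((-(2 * Real.exp (-‖z‖ ^ 2)) * inner ℝ z v : ℝ) : ℂ)
  congr 1
  ring

theorem continuous_planarGaussian : Continuous planarGaussian := by
  unfold planarGaussian; fun_prop

theorem isBigO_planarGaussian_sub_one (c : ℂ) :
    (fun z => planarGaussian (z - c) - 1) =O[𝓝 c] fun z => z - c := by
  simpa [Function.comp_def, planarGaussian_zero] using
    (hasFDerivAt_planarGaussian 0).isBigO_sub.comp_tendsto (tendsto_sub_self_nhds c)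

theorem norm_fderivPlanarGaussian_add_le {w : ℂ} (hw : ‖w‖ ≤ 1) (z : ℂ) :
    ‖fderivPlanarGaussian (z + w)‖ ≤ 2 * Real.exp (1 / 2) * Real.exp (-(1 / 4) * ‖z‖ ^ 2) := by
  set t := ‖z + w‖
  have hz : ‖z‖ ≤ t + 1 := by
    simpa using (norm_sub_le (z + w) w).trans (add_le_add_right hw t)
  have ht : t ≤ Real.exp (t ^ 2 / 2) := by
    nlinarith [Real.add_one_le_exp (t ^ 2 / 2), sq_nonneg (t - 1)]
  calc ‖fderivPlanarGaussian (z + w)‖ ≤ 2 * Real.exp (-t ^ 2) * t := by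
        refine (ContinuousLinearMap.opNorm_comp_le _ _).trans_eq ?_
        rw [Complex.ofRealCLM_norm, one_mul, norm_smul, norm_neg, innerSL_apply_norm,
          Real.norm_of_nonneg (by positivity)]
    _ ≤ 2 * Real.exp (-t ^ 2) * Real.exp (t ^ 2 / 2) := by gcongr
    _ = 2 * Real.exp (-t ^ 2 / 2) := by rw [mul_assoc, ← Real.exp_add]; ring_nf
    _ ≤ 2 * Real.exp (1 / 2 + -(1 / 4) * ‖z‖ ^ 2) := by
        gcongr
        nlinarith [sq_nonneg (t - 1), norm_nonneg z]
    _ = _ := by rw [Real.exp_add, mul_assoc]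

theorem integral_inv_mul_fderivPlanarGaussian (v : ℂ) :
    ∫ z, z⁻¹ * fderivPlanarGaussian z v = -(Real.pi * star v) := by
  have hodd : ∫ z, star z * z⁻¹ * planarGaussian z = 0 :=
    integral_eq_zero_of_comp_I_mul_eq_neg fun z => by
      rw [planarGaussian_I_mul, star_mul', mul_inv, Complex.inv_I, Complex.star_def, Complex.conj_I]
      linear_combination (starRingEnd ℂ z * z⁻¹ * planarGaussian z) * Complex.I_sq
  have hodd_int : Integrable fun z => star z * z⁻¹ * planarGaussian z := by
    refine integrable_planarGaussian.norm.mono' ?_ (.of_forall fun z => ?_)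
    · exact (continuous_star.measurable.mul measurable_inv).aestronglyMeasurable.mul
        continuous_planarGaussian.aestronglyMeasurable
    · rw [norm_mul, norm_mul, norm_star, norm_inv]
      exact mul_le_of_le_one_left (norm_nonneg _) mul_inv_le_one
  calc ∫ z, z⁻¹ * fderivPlanarGaussian z v
      = ∫ z, (-v * (star z * z⁻¹ * planarGaussian z) + -star v * planarGaussian z) := by
        refine integral_congr_ae ?_
        filter_upwards [Measure.ae_ne volume 0] with z hz
        have hinner : (2 * inner ℝ z v : ℂ) = star z * v + z * star v := by
          apply Complex.ext <;> simp [Complex.inner] <;> ring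
        have hD : fderivPlanarGaussian z v = -planarGaussian z * (2 * inner ℝ z v : ℂ) := by
          simp only [fderivPlanarGaussian, planarGaussian, ContinuousLinearMap.comp_apply,
            _root_.smul_apply, innerSL_apply_apply, smul_eq_mul,
            Complex.ofRealCLM_apply]
          push_cast
          ring
        rw [hD, hinner]
        field_simp
        ring
    _ = _ := by
        rw [integral_add (hodd_int.const_mul _) (integrable_planarGaussian.const_mul _),
          integral_const_mul, integral_const_mul, hodd, integral_planarGaussian]
        ring

theorem integrable_inv_mul_exp_neg_mul_norm_sq (C : ℝ) {b : ℝ} (hb : 0 < b) :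
    Integrable fun z : ℂ => ‖z‖⁻¹ * (C * Real.exp (-b * ‖z‖ ^ 2)) := by
  have h := integrable_norm_sub_rpow_neg_mul (c := 0) (M := 1) zero_le_one one_lt_two
    (integrable_exp_neg_mul_norm_sq hb) (fun z => (Real.exp_pos _).le) one_pos
    (fun z _ => Real.exp_le_one_iff.2 (by nlinarith [sq_nonneg ‖z‖]))
  simpa [Real.rpow_neg_one, mul_left_comm] using h.const_mul C

theorem norm_inv_smul_fderivPlanarGaussian_add_le {w : ℂ} (hw : ‖w‖ ≤ 1) (z : ℂ) :
    ‖z⁻¹ • fderivPlanarGaussian (z + w)‖ ≤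
      ‖z‖⁻¹ * (2 * Real.exp (1 / 2) * Real.exp (-(1 / 4) * ‖z‖ ^ 2)) := by
  rw [norm_smul, norm_inv]
  gcongr
  exact norm_fderivPlanarGaussian_add_le hw z

theorem cauchyTransform_planarGaussian (w : ℂ) :
    cauchyTransform planarGaussian w = ∫ z, z⁻¹ * planarGaussian (z + w) := by
  simpa [cauchyTransform] using (integral_add_right_eq_self (μ := volume)
    (fun z => (z - w)⁻¹ • planarGaussian z) w).symm

theorem hasFDerivAt_cauchyTransform_planarGaussian :
    HasFDerivAt (cauchyTransform planarGaussian)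
      (-(Real.pi • (Complex.conjCLE : ℂ →L[ℝ] ℂ))) 0 := by
  have hmeas (w : ℂ) : AEStronglyMeasurable fun z : ℂ => z⁻¹ * planarGaussian (z + w) :=
    measurable_inv.aestronglyMeasurable.mul
      (continuous_planarGaussian.comp (continuous_add_const w)).aestronglyMeasurable
  have hint : Integrable fun z => z⁻¹ * planarGaussian (z + 0) := by
    simpa using integrable_inv_sub_smul (c := 0) integrable_planarGaussian
      (continuous_planarGaussian.continuousAt.isBigO_one ℝ)
  have hmeas' : AEStronglyMeasurable fun z : ℂ => z⁻¹ • fderivPlanarGaussian (z + 0) := by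
    refine measurable_inv.aestronglyMeasurable.smul (Continuous.aestronglyMeasurable ?_)
    unfold fderivPlanarGaussian
    fun_prop
  have hbound := integrable_inv_mul_exp_neg_mul_norm_sq (2 * Real.exp (1 / 2)) (b := 1 / 4)
    (by norm_num)
  have hderiv (w z : ℂ) : HasFDerivAt (fun w => z⁻¹ * planarGaussian (z + w))
      (z⁻¹ • fderivPlanarGaussian (z + w)) w :=
    ((hasFDerivAt_planarGaussian (z + w)).comp w ((hasFDerivAt_id w).const_add z)).const_mul z⁻¹
  have hD := hasFDerivAt_integral_of_dominated_of_fderiv_le (ball_mem_nhds (0 : ℂ) one_pos)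
    (.of_forall hmeas) hint (F' := fun w z => z⁻¹ • fderivPlanarGaussian (z + w)) hmeas'
    (.of_forall fun z _ hw => norm_inv_smul_fderivPlanarGaussian_add_le
      (mem_ball_zero_iff.1 hw).le z) hbound (.of_forall fun z w _ => hderiv w z)
  rw [funext cauchyTransform_planarGaussian]
  refine hD.congr_fderiv (ContinuousLinearMap.ext fun v => ?_)
  rw [ContinuousLinearMap.integral_apply (hbound.mono' hmeas' (.of_forall fun z =>
    norm_inv_smul_fderivPlanarGaussian_add_le (by simp) z))]
  simpa using integral_inv_mul_fderivPlanarGaussian v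

section ShrinkingBalls

variable {E : Type*} [NormedAddCommGroup E] [NormedSpace ℝ E] {g : ℂ → E} {c : ℂ}

theorem tendsto_setIntegral_ball {r : ℝ} (hr : 0 < r)
    (hg : IntegrableOn g (ball c r)) :
    Tendsto (fun ε => ∫ z in ball c ε, g z) (𝓝[>] 0) (𝓝 0) := by
  have hvol : Tendsto (fun ε => volume (ball c ε)) (𝓝[>] (0 : ℝ)) (𝓝 0) := by
    simp only [Complex.volume_ball]
    refine Tendsto.mono_left (Continuous.tendsto' ?_ _ _ (by simp)) nhdsWithin_le_nhds
    exact (ENNReal.continuous_mul_const ENNReal.coe_ne_top).comp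
      ((ENNReal.continuous_pow 2).comp ENNReal.continuous_ofReal)
  have hvol' : Tendsto (fun ε => volume.restrict (ball c r) (ball c ε)) (𝓝[>] (0 : ℝ)) (𝓝 0) :=
    tendsto_of_tendsto_of_tendsto_of_le_of_le tendsto_const_nhds hvol (fun _ => zero_le)
      fun ε => Measure.restrict_apply_le _ _
  refine (hg.tendsto_setIntegral_nhds_zero hvol').congr' ?_
  filter_upwards [Ioo_mem_nhdsGT hr] with ε hε
  rw [Measure.restrict_restrict measurableSet_ball, Set.inter_eq_left.2 (ball_subset_ball hε.2.le)]

theorem tendsto_setIntegral_compl_ball_union {c' : ℂ} (hc : c ≠ c') {V : E}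
    (hg : ∀ ε > 0, IntegrableOn g (ball c ε)ᶜ)
    (hV : Tendsto (fun ε => ∫ z in (ball c ε)ᶜ, g z) (𝓝[>] 0) (𝓝 V)) :
    Tendsto (fun ε => ∫ z in (ball c ε ∪ ball c' ε)ᶜ, g z) (𝓝[>] 0) (𝓝 V) := by
  have hd : 0 < dist c c' / 2 := half_pos (dist_pos.2 hc)
  have hsub {ε : ℝ} (hε : ε ≤ dist c c' / 2) : ball c' ε ⊆ (ball c ε)ᶜ :=
    (ball_disjoint_ball (by rw [dist_comm]; linarith)).subset_compl_right
  have hlim := hV.sub (tendsto_setIntegral_ball hd ((hg _ hd).mono_set (hsub le_rfl)))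
  rw [sub_zero] at hlim
  refine hlim.congr' ?_
  filter_upwards [Ioo_mem_nhdsGT hd] with ε hε
  rw [Set.compl_union, ← Set.sdiff_eq,
    setIntegral_sdiff measurableSet_ball (hg ε hε.1) (hsub hε.2.le)]

end ShrinkingBalls

section BeurlingTransform

variable {E : Type*} [NormedAddCommGroup E] [NormedSpace ℂ E] {f : ℂ → E} {c : ℂ}

/-- `f` with its value at `c` subtracted off by means of a Gaussian, so that integrability on the
whole plane is kept. -/
def gaussianReduction (f : ℂ → E) (c z : ℂ) : E := f z - planarGaussian (z - c) • f c

theorem integrable_gaussianReduction (hf : Integrable f) (c : ℂ) :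
    Integrable (gaussianReduction f c) :=
  hf.sub ((integrable_planarGaussian.comp_sub_right c).smul_const (f c))

theorem isBigO_gaussianReduction (hO : (fun z => f z - f c) =O[𝓝 c] fun z => z - c) :
    gaussianReduction f c =O[𝓝 c] fun z => z - c := by
  have hφ : (fun z => (planarGaussian (z - c) - 1) • f c) =O[𝓝 c] fun z => z - c := by
    simpa using (isBigO_planarGaussian_sub_one c).smul (isBigO_const_const (f c)
      (one_ne_zero (α := ℂ)) (𝓝 c))
  refine (hO.sub hφ).congr_left fun z => ?_
  rw [gaussianReduction, sub_smul, one_smul]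
  abel

/-- The Beurling transform `p.v. ∫ (z - c)⁻² f(z)`, in an absolutely convergent form: the principal
value of the Gaussian part vanishes. -/
def beurlingTransform (f : ℂ → E) (c : ℂ) : E :=
  ∫ z, ((z - c) ^ 2)⁻¹ • gaussianReduction f c z

theorem cauchyTransform_planarGaussian_sub_smul [CompleteSpace E] (b c : ℂ) (v : E) :
    cauchyTransform (fun z => planarGaussian (z - c) • v) b =
      cauchyTransform planarGaussian (b - c) • v := by
  simp only [cauchyTransform, smul_eq_mul]
  rw [← integral_smul_const, ← integral_add_right_eq_self _ c]
  simp only [smul_smul, add_sub_cancel_right, sub_sub_eq_add_sub]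

theorem cauchyTransform_eq_add_gaussian [CompleteSpace E] (hf : Integrable f) {c b : ℂ}
    (hb : f =O[𝓝 b] fun _ => (1 : ℝ)) :
    cauchyTransform f b = cauchyTransform (gaussianReduction f c) b +
      cauchyTransform planarGaussian (b - c) • f c := by
  have hφ : Integrable fun z => planarGaussian (z - c) • f c :=
    (integrable_planarGaussian.comp_sub_right c).smul_const (f c)
  have hφb : (fun z => planarGaussian (z - c) • f c) =O[𝓝 b] fun _ => (1 : ℝ) :=
    ((continuous_planarGaussian.comp (continuous_sub_right c)).smul
      continuous_const).continuousAt.isBigO_one ℝ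
  rw [← cauchyTransform_planarGaussian_sub_smul]
  simp only [cauchyTransform, gaussianReduction, smul_sub]
  rw [integral_sub (integrable_inv_sub_smul hf hb) (integrable_inv_sub_smul hφ hφb),
    sub_add_cancel]

theorem hasFDerivAt_cauchyTransform [CompleteSpace E] (hf : Integrable f)
    (hO : (fun z => f z - f c) =O[𝓝 c] fun z => z - c) :
    HasFDerivAt (cauchyTransform f)
      ((ContinuousLinearMap.id ℝ ℂ).smulRight (beurlingTransform f c) -
        Real.pi • (Complex.conjCLE : ℂ →L[ℝ] ℂ).smulRight (f c)) c := by
  have hreg := (hasDerivAt_cauchyTransform (integrable_gaussianReduction hf c)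
    (isBigO_gaussianReduction hO)).hasFDerivAt.restrictScalars ℝ
  have hφ : HasFDerivAt (fun b => cauchyTransform planarGaussian (b - c))
      (-(Real.pi • (Complex.conjCLE : ℂ →L[ℝ] ℂ))) c := by
    rw [hasFDerivAt_comp_sub, sub_self]
    exact hasFDerivAt_cauchyTransform_planarGaussian
  refine ((hreg.add (hφ.smul_const (f c))).congr_of_eventuallyEq ?_).congr_fderiv ?_
  · filter_upwards [eventually_isBigO_one (isBigO_one_of_sub_isBigO hO)] with b hb
    exact cauchyTransform_eq_add_gaussian hf hb
  · ext v
    simp [beurlingTransform, sub_eq_add_neg, mul_smul]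

theorem integrableOn_inv_sub_sq_smul (hf : Integrable f) (c : ℂ) {ε : ℝ} (hε : 0 < ε) :
    IntegrableOn (fun z => ((z - c) ^ 2)⁻¹ • f z) (ball c ε)ᶜ := by
  refine (hf.norm.const_mul (ε ^ 2)⁻¹).integrableOn.mono' ?_ ?_
  · exact (((measurable_sub_const c).pow_const 2).inv.aestronglyMeasurable.smul
      hf.aestronglyMeasurable).restrict
  · refine ae_restrict_of_forall_mem measurableSet_ball.compl fun z hz => ?_
    have : ε ≤ ‖z - c‖ := by simpa [dist_eq_norm] using hz
    rw [norm_smul, norm_inv, norm_pow]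
    gcongr

theorem tendsto_setIntegral_inv_sq_smul [CompleteSpace E] (hf : Integrable f)
    (hO : (fun z => f z - f c) =O[𝓝 c] fun z => z - c) :
    Tendsto (fun ε => ∫ z in (ball c ε)ᶜ, ((z - c) ^ 2)⁻¹ • f z) (𝓝[>] 0)
      (𝓝 (beurlingTransform f c)) := by
  have hφ : Integrable fun z => planarGaussian (z - c) • f c :=
    (integrable_planarGaussian.comp_sub_right c).smul_const (f c)
  have hg := integrable_inv_sub_sq_smul (integrable_gaussianReduction hf c)
    (isBigO_gaussianReduction hO)
  have hgauss (ε : ℝ) : ∫ z in (ball c ε)ᶜ, ((z - c) ^ 2)⁻¹ • planarGaussian (z - c) • f c = 0 := by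
    simp only [smul_smul]
    rw [integral_smul_const]
    simpa using Or.inl (setIntegral_inv_sub_sq_mul_planarGaussian c ε)
  have hlim := (tendsto_setIntegral_ball (c := c) one_pos hg.integrableOn).const_sub
    (beurlingTransform f c)
  rw [sub_zero] at hlim
  refine hlim.congr' ?_
  filter_upwards [self_mem_nhdsWithin] with ε hε
  rw [beurlingTransform, ← setIntegral_compl measurableSet_ball hg]
  simp only [gaussianReduction, smul_sub]
  rw [integral_sub (integrableOn_inv_sub_sq_smul hf c hε) (integrableOn_inv_sub_sq_smul hφ c hε),
    hgauss, sub_zero]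

end BeurlingTransform

section SlicePlane

variable {m : ℕ}

theorem vecCl_mul_self_of_norm_eq_one {J : Vec m} (hJ : ‖J‖ = 1) : vecCl J * vecCl J = -1 := by
  rw [vecCl_mul_self, hJ]
  simp

theorem vecCl_mul_vecCl_mul_of_norm_eq_one {J : Vec m} (hJ : ‖J‖ = 1) (x : Cl m) :
    vecCl J * (vecCl J * x) = -x := by
  rw [← mul_assoc, vecCl_mul_self_of_norm_eq_one hJ, neg_one_mul]

/-- The identification `u + i v ↦ u + J v` of `ℂ` with the plane `ℂ_J` in the Clifford algebra. -/
def planeHom {J : Vec m} (hJ : ‖J‖ = 1) : ℂ →ₐ[ℝ] Cl m :=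
  Complex.liftAux (vecCl J) (vecCl_mul_self_of_norm_eq_one hJ)

section PlaneHom

variable {J : Vec m} (hJ : ‖J‖ = 1)

theorem planeHom_apply (z : ℂ) :
    planeHom hJ z = algebraMap ℝ (Cl m) z.re + z.im • vecCl J :=
  Complex.liftAux_apply _ _ z

theorem planeHom_I : planeHom hJ Complex.I = vecCl J :=
  Complex.liftAux_apply_I _ _

theorem inverse_planeHom {z : ℂ} (hz : z ≠ 0) :
    Ring.inverse (planeHom hJ z) = planeHom hJ z⁻¹ :=
  Ring.inverse_unit (Units.map (planeHom hJ : ℂ →* Cl m) (Units.mk0 z hz))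

theorem star_planeHom (z : ℂ) : star (planeHom hJ z) = planeHom hJ (star z) := by
  rw [planeHom_apply, planeHom_apply, star_add, CliffordAlgebra.star_algebraMap,
    CliffordAlgebra.star_smul, vecCl, CliffordAlgebra.star_ι, smul_neg]
  simp

theorem paraCl_slicePt (z : ℂ) : paraCl (slicePt J z) = planeHom hJ z := by
  have hvec : vec (slicePt J z) = z.im • J := rfl
  rw [paraCl, hvec, planeHom_apply, vecCl, map_smul]
  rfl

theorem sq_planeHom_sub_smul_add (c z : ℂ) :
    planeHom hJ c ^ 2 - (2 * z.re) • planeHom hJ c + algebraMap ℝ (Cl m) (‖z‖ ^ 2) =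
      planeHom hJ ((c - z) * (c - star z)) := by
  have hre : ((2 * z.re : ℝ) : ℂ) = z + star z := (Complex.add_conj z).symm
  have hnorm : ((‖z‖ ^ 2 : ℝ) : ℂ) = z * star z := by
    rw [← Complex.normSq_eq_norm_sq]
    exact (Complex.mul_conj z).symm
  have hfactor : (c - z) * (c - star z) =
      c ^ 2 - (2 * z.re) • c + algebraMap ℝ ℂ (‖z‖ ^ 2) := by
    rw [Complex.real_smul, hre, Complex.coe_algebraMap, hnorm]
    ring
  rw [hfactor, map_add, map_sub, map_pow (planeHom hJ), map_smul, AlgHom.commutes]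

end PlaneHom

theorem norm_sq_eq_sq_add_norm_vec_sq (x : Para m) : ‖x‖ ^ 2 = x 0 ^ 2 + ‖vec x‖ ^ 2 := by
  rw [EuclideanSpace.norm_sq_eq, EuclideanSpace.norm_sq_eq, Fin.sum_univ_succ]
  simp only [vec, Real.norm_eq_abs, sq_abs]

theorem para_ext {x y : Para m} (hre : x 0 = y 0) (hvec : vec x = vec y) : x = y := by
  ext i
  exact Fin.cases hre (fun j => congrArg (fun v : Vec m => v j) hvec) i

theorem norm_slicePt {J : Vec m} (hJ : ‖J‖ = 1) (z : ℂ) : ‖slicePt J z‖ = ‖z‖ := by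
  have hvec : vec (slicePt J z) = z.im • J := rfl
  have hre : slicePt J z 0 = z.re := rfl
  rw [← sq_eq_sq₀ (norm_nonneg _) (norm_nonneg _), norm_sq_eq_sq_add_norm_vec_sq, hvec, hre,
    norm_smul, hJ, mul_one, Real.norm_eq_abs, sq_abs, Complex.sq_norm, Complex.normSq_apply]
  ring

theorem norm_unitVec {q : Para m} (hq : q ∈ nonreal m) : ‖unitVec q‖ = 1 :=
  norm_smul_inv_norm (𝕜 := ℝ) hq

theorem norm_vec_smul_unitVec {q : Para m} (hq : q ∈ nonreal m) :
    ‖vec q‖ • unitVec q = vec q :=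
  smul_inv_smul₀ (norm_ne_zero_iff.2 hq) _

theorem slicePt_unitVec_planeCoord {q : Para m} (hq : q ∈ nonreal m) :
    slicePt (unitVec q) (planeCoord q) = q :=
  para_ext rfl (norm_vec_smul_unitVec hq)

theorem paraCl_eq_planeHom {q : Para m} (hq : q ∈ nonreal m) :
    paraCl q = planeHom (norm_unitVec hq) (planeCoord q) := by
  rw [← paraCl_slicePt, slicePt_unitVec_planeCoord hq]

theorem star_planeCoord_ne {q : Para m} (hq : q ∈ nonreal m) :
    star (planeCoord q) ≠ planeCoord q := by
  intro h
  have him : -‖vec q‖ = ‖vec q‖ := congrArg Complex.im h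
  linarith [norm_pos_iff.2 hq]

end SlicePlane

section SliceExtension

variable {m : ℕ}

/-- The slice extension `q ↦ α g(z) + β g(z̄)`, `z = q₀ + i |vec q|`, of a function `g` on the plane
`ℂ_I`, whose points `u + I v` are written as `u + i v`. -/
def sliceExt (I : Vec m) (g : ℂ → Cl m) (q : Para m) : Cl m :=
  alpha I q * g (planeCoord q) + beta I q * g (star (planeCoord q))

variable {I : Vec m} (hI : ‖I‖ = 1) {q : Para m} (hq : q ∈ nonreal m)
include hI

theorem planeHom_unitVec_eq (w : ℂ) :
    planeHom (norm_unitVec hq) w =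
      alpha I q * planeHom hI w + beta I q * planeHom hI (star w) := by
  simp only [planeHom_apply, alpha, beta, smul_mul_assoc, mul_smul_comm, sub_mul, add_mul, one_mul,
    mul_add, mul_assoc, vecCl_mul_self_of_norm_eq_one hI, Complex.star_def, Complex.conj_re,
    Complex.conj_im, Algebra.algebraMap_eq_smul_one, mul_neg, mul_one]
  module

include hq

theorem unitVec_mul_alpha : vecCl (unitVec q) * alpha I q = alpha I q * vecCl I := by
  simp only [alpha, mul_smul_comm, smul_mul_assoc, mul_sub, sub_mul, mul_one, one_mul, mul_assoc,
    mul_neg, vecCl_mul_self_of_norm_eq_one hI,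
    vecCl_mul_vecCl_mul_of_norm_eq_one (norm_unitVec hq)]
  module

theorem unitVec_mul_beta : vecCl (unitVec q) * beta I q = -(beta I q * vecCl I) := by
  simp only [beta, mul_smul_comm, smul_mul_assoc, mul_add, add_mul, mul_one, one_mul, mul_assoc,
    mul_neg, vecCl_mul_self_of_norm_eq_one hI,
    vecCl_mul_vecCl_mul_of_norm_eq_one (norm_unitVec hq)]
  module

theorem cauchyKernel_slicePt_eq_sliceExt {z : ℂ} (hz : z ≠ planeCoord q)
    (hz' : z ≠ star (planeCoord q)) :
    cauchyKernel q (slicePt I z) = sliceExt I (fun c => planeHom hI (z - c)⁻¹) q := by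
  set c := planeCoord q
  have hcz : c - z ≠ 0 := sub_ne_zero.2 hz.symm
  have hcz' : c - star z ≠ 0 := sub_ne_zero.2 fun h => hz' (by rw [h, star_star])
  have hN : (c - z) * (c - star z) ≠ 0 := mul_ne_zero hcz hcz'
  have hα : (z - c)⁻¹ = -(((c - z) * (c - star z))⁻¹ * (c - star z)) := by
    rw [mul_inv, inv_mul_cancel_right₀ hcz', ← inv_neg, neg_sub]
  have hβ : (z - star c)⁻¹ = -(star ((c - z) * (c - star z))⁻¹ * (star c - star z)) := by
    have hstar : star c - star z ≠ 0 := by rwa [← star_sub, star_ne_zero]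
    rw [star_inv₀, star_mul', star_sub, star_sub, star_star, mul_inv, mul_right_comm,
      inv_mul_cancel₀ hstar, one_mul, ← inv_neg, neg_sub]
  have hre : slicePt I z 0 = z.re := rfl
  rw [cauchyKernel, paraCl_eq_planeHom hq, hre, norm_slicePt hI, sq_planeHom_sub_smul_add,
    inverse_planeHom _ hN, paraCl_slicePt hI, star_planeHom, mul_sub, ← map_mul,
    planeHom_unitVec_eq hI hq, planeHom_unitVec_eq hI hq, sliceExt, hα, hβ]
  simp only [c, add_mul, mul_assoc, ← map_mul, star_mul', mul_sub, map_neg, map_sub, mul_neg]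
  abel

end SliceExtension

theorem IsSlice.sliceExt_eq {m : ℕ} {D : Set ℂ} (hconj : ∀ z ∈ D, star z ∈ D) {f : Para m → Cl m}
    (hf : IsSlice D f) {I : Vec m} (hI : ‖I‖ = 1) {q : Para m} (hq : q ∈ nonreal m)
    (hqD : planeCoord q ∈ D) :
    sliceExt I (fun z => f (slicePt I z)) q = f q := by
  obtain ⟨F₁, F₂, hF, hf⟩ := hf
  have hunit := hf (unitVec q) (mem_sphere_zero_iff_norm.2 (norm_unitVec hq)) _ hqD
  rw [slicePt_unitVec_planeCoord hq] at hunit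
  have hIs := mem_sphere_zero_iff_norm.2 hI
  rw [sliceExt, hunit, hf I hIs _ hqD, hf I hIs _ (hconj _ hqD), (hF _ hqD).1, (hF _ hqD).2]
  simp only [alpha, beta, add_mul, sub_mul, smul_mul_assoc, one_mul, mul_add, mul_assoc,
    mul_neg, vecCl_mul_vecCl_mul_of_norm_eq_one hI]
  module

section Derivatives

theorem hasFDerivAt_norm_of_ne_zero {F : Type*} [NormedAddCommGroup F] [InnerProductSpace ℝ F]
    {x : F} (hx : x ≠ 0) : HasFDerivAt (fun y : F => ‖y‖) (innerSL ℝ (‖x‖⁻¹ • x)) x := by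
  have hsqrt := (hasStrictFDerivAt_norm_sq x).hasFDerivAt.sqrt
    (pow_ne_zero 2 (norm_ne_zero_iff.2 hx))
  simp only [Real.sqrt_sq (norm_nonneg _)] at hsqrt
  refine hsqrt.congr_fderiv ?_
  ext y
  simp only [innerSL_apply_apply, smul_apply, real_inner_smul_left, smul_eq_mul,
    nsmul_eq_mul, Nat.cast_ofNat]
  ring

variable {m : ℕ}

/-- `vec` as a continuous linear map. -/
def vecCLM (m : ℕ) : Para m →L[ℝ] Vec m :=
  LinearMap.toContinuousLinearMap
    { toFun := vec
      map_add' := fun _ _ => rfl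
      map_smul' := fun _ _ => rfl }

theorem vecCLM_apply (x : Para m) (i : Fin m) : vecCLM m x i = x i.succ := rfl

theorem vecCLM_slicePt (J : Vec m) (z : ℂ) : vecCLM m (slicePt J z) = z.im • J := rfl

theorem vecCLM_single_zero : vecCLM m (EuclideanSpace.single 0 1) = 0 := by
  ext i
  simp [vecCLM_apply]

theorem vecCLM_single_succ (i : Fin m) :
    vecCLM m (EuclideanSpace.single i.succ 1) = EuclideanSpace.single i 1 := by
  ext j
  simp [vecCLM_apply]

/-- `vecCl` as a continuous linear map. -/
def vecClCLM (m : ℕ) : Vec m →L[ℝ] Cl m :=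
  LinearMap.toContinuousLinearMap (CliffordAlgebra.ι (negSq m))

/-- The multiplication of `Cl_m` as a continuous bilinear map. The coordinate norm of `Cl_m` is not
submultiplicative, so that the calculus of normed algebras does not apply. -/
def mulCLM (m : ℕ) : Cl m →L[ℝ] Cl m →L[ℝ] Cl m :=
  (LinearMap.mul ℝ (Cl m)).toContinuousBilinearMap

/-- The Fréchet derivative of `planeCoord` at a nonreal paravector. -/
def planeCoordFDeriv (q : Para m) : Para m →L[ℝ] ℂ :=
  (EuclideanSpace.proj (0 : Fin (m + 1)) : Para m →L[ℝ] ℝ).smulRight (1 : ℂ) +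
    ((innerSL ℝ (unitVec q)).comp (vecCLM m)).smulRight Complex.I

/-- The Fréchet derivative of `unitVec` at a nonreal paravector. -/
def unitVecFDeriv (q : Para m) : Para m →L[ℝ] Vec m :=
  ‖vec q‖⁻¹ • (vecCLM m - ((innerSL ℝ (unitVec q)).comp (vecCLM m)).smulRight (unitVec q))

variable {q : Para m} (hq : q ∈ nonreal m)
include hq

theorem hasFDerivAt_norm_vec :
    HasFDerivAt (fun p : Para m => ‖vec p‖) ((innerSL ℝ (unitVec q)).comp (vecCLM m)) q :=
  HasFDerivAt.comp q (g := fun v : Vec m => ‖v‖) (hasFDerivAt_norm_of_ne_zero hq)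
    (vecCLM m).hasFDerivAt

theorem hasFDerivAt_planeCoord : HasFDerivAt planeCoord (planeCoordFDeriv q) q := by
  have hsum : (planeCoord : Para m → ℂ) = fun p => p 0 • (1 : ℂ) + ‖vec p‖ • Complex.I := by
    funext p
    apply Complex.ext <;> simp [planeCoord]
  rw [hsum]
  exact ((EuclideanSpace.proj (0 : Fin (m + 1)) : Para m →L[ℝ] ℝ).hasFDerivAt.smul_const 1).add
    ((hasFDerivAt_norm_vec hq).smul_const Complex.I)

theorem hasFDerivAt_unitVec : HasFDerivAt unitVec (unitVecFDeriv q) q := by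
  have hnorm : ‖vec q‖ ≠ 0 := norm_ne_zero_iff.2 hq
  have hvec : vecCLM m q = ‖vec q‖ • unitVec q := (norm_vec_smul_unitVec hq).symm
  refine (((hasDerivAt_inv hnorm).comp_hasFDerivAt q (hasFDerivAt_norm_vec hq)).smul
    (vecCLM m).hasFDerivAt).congr_fderiv ?_
  ext v : 1
  simp only [unitVecFDeriv, hvec, add_apply, smul_apply, sub_apply,
    ContinuousLinearMap.smulRight_apply, ContinuousLinearMap.comp_apply, smul_sub, smul_smul,
    Function.comp_apply, smul_eq_mul]
  match_scalars <;> field_simp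

omit hq in
theorem planeCoordFDeriv_single_zero : planeCoordFDeriv q (EuclideanSpace.single 0 1) = 1 := by
  simp [planeCoordFDeriv, vecCLM_single_zero]

omit hq in
theorem planeCoordFDeriv_single_succ (i : Fin m) :
    planeCoordFDeriv q (EuclideanSpace.single i.succ 1) =
      (q i.succ / ‖vec q‖) • Complex.I := by
  have hcoord : unitVec q i = q i.succ / ‖vec q‖ := (div_eq_inv_mul _ _).symm
  simp [planeCoordFDeriv, vecCLM_single_succ, EuclideanSpace.inner_single_right, hcoord]

omit hq in
theorem unitVecFDeriv_single_zero : unitVecFDeriv q (EuclideanSpace.single 0 1) = 0 := by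
  simp [unitVecFDeriv, vecCLM_single_zero]

theorem planeCoordFDeriv_slicePt_I :
    planeCoordFDeriv q (slicePt (unitVec q) Complex.I) = Complex.I := by
  have hre : slicePt (unitVec q) Complex.I 0 = 0 := rfl
  simp [planeCoordFDeriv, vecCLM_slicePt, hre, norm_unitVec hq]

theorem unitVecFDeriv_slicePt_I : unitVecFDeriv q (slicePt (unitVec q) Complex.I) = 0 := by
  simp [unitVecFDeriv, vecCLM_slicePt, norm_unitVec hq]

theorem hasRadialDeriv_of_hasFDerivAt {h : Para m → Cl m} {h' : Para m →L[ℝ] Cl m}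
    (hh : HasFDerivAt h h' q) : HasRadialDeriv h (h' (slicePt (unitVec q) Complex.I)) q := by
  have hcurve : (fun ζ : ℝ => slicePt (unitVec q) ⟨q 0, ζ⟩) =
      fun ζ => slicePt (unitVec q) ⟨q 0, 0⟩ + ζ • slicePt (unitVec q) Complex.I := by
    funext ζ
    refine para_ext ?_ ?_
    · simp [slicePt]
    · ext i
      simp [slicePt, vec]
  have hderiv : HasDerivAt (fun ζ : ℝ => slicePt (unitVec q) ⟨q 0, ζ⟩)
      (slicePt (unitVec q) Complex.I) ‖vec q‖ := by
    rw [hcurve]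
    simpa using ((hasDerivAt_id ‖vec q‖).smul_const
      (slicePt (unitVec q) Complex.I)).const_add (slicePt (unitVec q) ⟨q 0, 0⟩)
  have hend : slicePt (unitVec q) ⟨q 0, ‖vec q‖⟩ = q := slicePt_unitVec_planeCoord hq
  exact (hend.symm ▸ hh).comp_hasDerivAt ‖vec q‖ hderiv

theorem opG_eq_of_hasFDerivAt {h : Para m → Cl m} {h' : Para m →L[ℝ] Cl m}
    (hh : HasFDerivAt h h' q) :
    opG h q = h' (EuclideanSpace.single 0 1) +
      vecCl (unitVec q) * h' (slicePt (unitVec q) Complex.I) := by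
  have hnorm : ‖vec q‖ ≠ 0 := norm_ne_zero_iff.2 hq
  have hsum : ∑ j : Fin m, q j.succ • EuclideanSpace.single j.succ (1 : ℝ) =
      ‖vec q‖ • slicePt (unitVec q) Complex.I := by
    refine para_ext ?_ ?_
    · simp [slicePt]
    · change vecCLM m _ = vecCLM m _
      simp only [map_sum, map_smul, vecCLM_single_succ, vecCLM_slicePt, Complex.I_im, one_smul,
        norm_vec_smul_unitVec hq]
      ext i
      simp [vec, Pi.single_apply]
  have hradial : ∑ j : Fin m, q j.succ • lineDeriv ℝ h q (EuclideanSpace.single j.succ 1) =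
      ‖vec q‖ • h' (slicePt (unitVec q) Complex.I) := by
    simp only [(hh.hasLineDerivAt _).lineDeriv, ← map_smul, ← map_sum, hsum]
  have hunit : (‖vec q‖ ^ 2)⁻¹ * ‖vec q‖ = ‖vec q‖⁻¹ := by
    field_simp
  rw [opG, (hh.hasLineDerivAt _).lineDeriv, hradial, mul_smul_comm, smul_smul, hunit,
    ← smul_mul_assoc, unitVec, vecCl, vecCl, map_smul]

end Derivatives

section SliceExtensionDerivative

variable {m : ℕ}

/-- The Fréchet derivative at `q` of the slice extension of `g`, in terms of the derivatives `g₁'`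
and `g₂'` of `g` at the two points `q₀ ± i |vec q|`. -/
def sliceExtFDeriv (I : Vec m) (g : ℂ → Cl m) (g₁' g₂' : ℂ →L[ℝ] Cl m) (q : Para m) :
    Para m →L[ℝ] Cl m :=
  (mulCLM m (alpha I q)).comp (g₁'.comp (planeCoordFDeriv q)) +
    (mulCLM m (beta I q)).comp
      (g₂'.comp ((Complex.conjCLE : ℂ →L[ℝ] ℂ).comp (planeCoordFDeriv q))) +
    ((mulCLM m).flip ((1 / 2 : ℝ) •
      (vecCl I * (g (star (planeCoord q)) - g (planeCoord q))))).comp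
        ((vecClCLM m).comp (unitVecFDeriv q))

variable {I : Vec m} {g : ℂ → Cl m} {g₁' g₂' : ℂ →L[ℝ] Cl m} {q : Para m}

theorem sliceExtFDeriv_apply (v : Para m) : sliceExtFDeriv I g g₁' g₂' q v =
    alpha I q * g₁' (planeCoordFDeriv q v) + beta I q * g₂' (star (planeCoordFDeriv q v)) +
      vecCl (unitVecFDeriv q v) *
        ((1 / 2 : ℝ) • (vecCl I * (g (star (planeCoord q)) - g (planeCoord q)))) :=
  rfl

theorem sliceExtFDeriv_apply_of_unitVecFDeriv_eq_zero {v : Para m} (hv : unitVecFDeriv q v = 0) :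
    sliceExtFDeriv I g g₁' g₂' q v =
      alpha I q * g₁' (planeCoordFDeriv q v) + beta I q * g₂' (star (planeCoordFDeriv q v)) := by
  rw [sliceExtFDeriv_apply, hv, vecCl, map_zero, zero_mul, add_zero]

variable (hq : q ∈ nonreal m) (hg₁ : HasFDerivAt g g₁' (planeCoord q))
  (hg₂ : HasFDerivAt g g₂' (star (planeCoord q)))
include hq hg₁ hg₂

theorem hasFDerivAt_sliceExt : HasFDerivAt (sliceExt I g) (sliceExtFDeriv I g g₁' g₂' q) q := by
  have hJI : HasFDerivAt (fun p : Para m => vecCl (unitVec p) * vecCl I)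
      (((mulCLM m).flip (vecCl I)).comp ((vecClCLM m).comp (unitVecFDeriv q))) q :=
    ((mulCLM m).flip (vecCl I)).hasFDerivAt.comp q
      ((vecClCLM m).hasFDerivAt.comp q (hasFDerivAt_unitVec hq))
  have hα := (hJI.const_sub 1).const_smul (1 / 2 : ℝ)
  have hβ := (hJI.const_add 1).const_smul (1 / 2 : ℝ)
  have h₁ := hg₁.comp q (hasFDerivAt_planeCoord hq)
  have h₂ := hg₂.comp q (f := fun p : Para m => star (planeCoord p))
    ((Complex.conjCLE : ℂ →L[ℝ] ℂ).hasFDerivAt.comp q (hasFDerivAt_planeCoord hq))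
  refine (((mulCLM m).hasFDerivAt_of_bilinear hα h₁).add
    ((mulCLM m).hasFDerivAt_of_bilinear hβ h₂)).congr_fderiv ?_
  ext v : 1
  simp only [ContinuousLinearMap.precompR_apply, ContinuousLinearMap.precompL_apply,
    ContinuousLinearMap.comp_apply, add_apply, smul_apply, neg_apply, Function.comp_apply,
    sliceExtFDeriv_apply]
  change alpha I q * g₁' (planeCoordFDeriv q v) +
      ((1 / 2 : ℝ) • -(vecCl (unitVecFDeriv q v) * vecCl I)) * g (planeCoord q) +
      (beta I q * g₂' (star (planeCoordFDeriv q v)) +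
        ((1 / 2 : ℝ) • (vecCl (unitVecFDeriv q v) * vecCl I)) * g (star (planeCoord q))) = _
  simp only [smul_mul_assoc, mul_smul_comm, neg_mul, mul_sub, mul_assoc]
  module

theorem opG_sliceExt (hI : ‖I‖ = 1) :
    opG (sliceExt I g) q = alpha I q * (g₁' 1 + vecCl I * g₁' Complex.I) +
      beta I q * (g₂' 1 + vecCl I * g₂' Complex.I) := by
  rw [opG_eq_of_hasFDerivAt hq (hasFDerivAt_sliceExt hq hg₁ hg₂),
    sliceExtFDeriv_apply_of_unitVecFDeriv_eq_zero unitVecFDeriv_single_zero,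
    sliceExtFDeriv_apply_of_unitVecFDeriv_eq_zero (unitVecFDeriv_slicePt_I hq),
    planeCoordFDeriv_single_zero, planeCoordFDeriv_slicePt_I hq, mul_add, ← mul_assoc,
    ← mul_assoc, unitVec_mul_alpha hI hq, unitVec_mul_beta hI hq, star_one, Complex.star_def,
    Complex.conj_I, map_neg]
  simp only [mul_add, mul_assoc, neg_mul, mul_neg, neg_neg]
  abel

end SliceExtensionDerivative

section CliffordValuedTransforms

variable {m : ℕ}

/-- The coordinates of an element of `Cl_m`, as complex numbers. They reduce integrals over a plane
`ℂ_I` with values in `Cl_m` to integrals over `ℂ` with values in a complex vector space. -/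
def complexCoords (m : ℕ) : Cl m →L[ℝ] (Finset (Fin m) → ℂ) :=
  ContinuousLinearMap.pi fun A =>
    Complex.ofRealCLM.comp (LinearMap.toContinuousLinearMap ((stdBasis m).coord A))

variable {I : Vec m} (hI : ‖I‖ = 1)

/-- The element `∑_A w_A e_A` of `Cl_m` for `w_A ∈ ℂ_I`, where `ℂ_I` is identified with `ℂ`. -/
def planeSum : (Finset (Fin m) → ℂ) →L[ℝ] Cl m :=
  LinearMap.toContinuousLinearMap
    (∑ A, (LinearMap.mulRight ℝ (stdBasis m A) ∘ₗ (planeHom hI).toLinearMap) ∘ₗ LinearMap.proj A)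

theorem planeSum_apply (w : Finset (Fin m) → ℂ) :
    planeSum hI w = ∑ A, planeHom hI (w A) * stdBasis m A := by
  simp [planeSum]

theorem planeSum_smul (z : ℂ) (w : Finset (Fin m) → ℂ) :
    planeSum hI (z • w) = planeHom hI z * planeSum hI w := by
  simp only [planeSum_apply, Pi.smul_apply, smul_eq_mul, map_mul, mul_assoc, Finset.mul_sum]

theorem planeSum_complexCoords (y : Cl m) : planeSum hI (complexCoords m y) = y := by
  have hcoord (A : Finset (Fin m)) :
      planeHom hI (complexCoords m y A) = algebraMap ℝ (Cl m) ((stdBasis m).repr y A) :=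
    (planeHom hI).commutes _
  simp only [planeSum_apply, hcoord, ← Algebra.smul_def]
  exact (stdBasis m).sum_repr y

theorem planeSum_smul_complexCoords (z : ℂ) (y : Cl m) :
    planeSum hI (z • complexCoords m y) = planeHom hI z * y := by
  rw [planeSum_smul, planeSum_complexCoords]

/-- The map `v ↦ v y` from `ℂ_I`, identified with `ℂ`, to `Cl_m`. -/
def planeMulCLM (y : Cl m) : ℂ →L[ℝ] Cl m :=
  ((mulCLM m).flip y).comp (LinearMap.toContinuousLinearMap (planeHom hI).toLinearMap)

theorem planeMulCLM_apply (y : Cl m) (v : ℂ) : planeMulCLM hI y v = planeHom hI v * y := rfl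

/-- The integral over `ℂ_I` of `(x - c)⁻¹ φ(x)`, with `ℂ_I` identified with `ℂ`. -/
def clCauchyTransform (φ : ℂ → Cl m) (c : ℂ) : Cl m :=
  ∫ z, planeHom hI (z - c)⁻¹ * φ z

/-- The principal value of the integral over `ℂ_I` of `(x - c)⁻² φ(x)`, with `ℂ_I` identified
with `ℂ`. -/
def clBeurlingTransform (φ : ℂ → Cl m) (c : ℂ) : Cl m :=
  planeSum hI (beurlingTransform (fun z => complexCoords m (φ z)) c)

/-- The Teodorescu transform on the plane `ℂ_I`, identified with `ℂ`. -/
def planarTeodorescu (φ : ℂ → Cl m) (c : ℂ) : Cl m :=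
  -(1 / (2 * Real.pi)) • clCauchyTransform hI φ c

/-- The Fréchet derivative of `planarTeodorescu`. -/
def planarTeodorescuFDeriv (φ : ℂ → Cl m) (c : ℂ) : ℂ →L[ℝ] Cl m :=
  -(1 / (2 * Real.pi)) • (planeMulCLM hI (clBeurlingTransform hI φ c) -
    Real.pi • (planeMulCLM hI (φ c)).comp (Complex.conjCLE : ℂ →L[ℝ] ℂ))

theorem planarTeodorescuFDeriv_apply (φ : ℂ → Cl m) (c v : ℂ) :
    planarTeodorescuFDeriv hI φ c v = -(1 / (2 * Real.pi)) •
      (planeHom hI v * clBeurlingTransform hI φ c - Real.pi • (planeHom hI (star v) * φ c)) :=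
  rfl

/-- The Cauchy-Riemann operator of `ℂ_I` inverts the Teodorescu transform: the holomorphic part of
the derivative cancels, and the antiholomorphic part contributes `φ c`. -/
theorem planarTeodorescuFDeriv_one_add (φ : ℂ → Cl m) (c : ℂ) :
    planarTeodorescuFDeriv hI φ c 1 + vecCl I * planarTeodorescuFDeriv hI φ c Complex.I = φ c := by
  have hpi : Real.pi ≠ 0 := Real.pi_ne_zero
  simp only [planarTeodorescuFDeriv_apply, star_one, map_one, one_mul, Complex.star_def,
    Complex.conj_I, map_neg, planeHom_I, neg_mul, mul_smul_comm, mul_sub, mul_neg, smul_neg,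
    vecCl_mul_vecCl_mul_of_norm_eq_one hI]
  match_scalars <;> field_simp <;> ring

variable {φ : ℂ → Cl m} {c : ℂ}

theorem integrable_complexCoords (hφ : Integrable φ) :
    Integrable fun z => complexCoords m (φ z) :=
  (complexCoords m).integrable_comp hφ

theorem isBigO_complexCoords_one (hb : φ =O[𝓝 c] fun _ => (1 : ℝ)) :
    (fun z => complexCoords m (φ z)) =O[𝓝 c] fun _ => (1 : ℝ) :=
  ((complexCoords m).isBigO_comp φ _).trans hb

theorem isBigO_complexCoords_sub (hO : (fun z => φ z - φ c) =O[𝓝 c] fun z => z - c) :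
    (fun z => complexCoords m (φ z) - complexCoords m (φ c)) =O[𝓝 c] fun z => z - c := by
  simpa only [map_sub] using
    ((complexCoords m).isBigO_comp (fun z => φ z - φ c) (𝓝 c)).trans hO

theorem integrable_planeHom_inv_sub_mul (hφ : Integrable φ) (hb : φ =O[𝓝 c] fun _ => (1 : ℝ)) :
    Integrable fun z => planeHom hI (z - c)⁻¹ * φ z := by
  simpa only [planeSum_smul_complexCoords] using (planeSum hI).integrable_comp
    (integrable_inv_sub_smul (integrable_complexCoords hφ) (isBigO_complexCoords_one hb))

theorem planeSum_cauchyTransform (hφ : Integrable φ) (hb : φ =O[𝓝 c] fun _ => (1 : ℝ)) :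
    planeSum hI (cauchyTransform (fun z => complexCoords m (φ z)) c) =
      clCauchyTransform hI φ c := by
  rw [cauchyTransform, ← ContinuousLinearMap.integral_comp_comm _
    (integrable_inv_sub_smul (integrable_complexCoords hφ) (isBigO_complexCoords_one hb))]
  simp only [planeSum_smul_complexCoords, clCauchyTransform]

theorem hasFDerivAt_planarTeodorescu (hφ : Integrable φ)
    (hO : (fun z => φ z - φ c) =O[𝓝 c] fun z => z - c) :
    HasFDerivAt (planarTeodorescu hI φ) (planarTeodorescuFDeriv hI φ c) c := by
  have hcoord := hasFDerivAt_cauchyTransform (integrable_complexCoords hφ)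
    (isBigO_complexCoords_sub hO)
  have hsum := ((planeSum hI).hasFDerivAt.comp c hcoord).const_smul (-(1 / (2 * Real.pi)))
  refine (hsum.congr_fderiv ?_).congr_of_eventuallyEq ?_
  · ext v : 1
    change -(1 / (2 * Real.pi)) • planeSum hI (v • _ - Real.pi • star v • complexCoords m (φ c)) = _
    rw [planarTeodorescuFDeriv_apply, map_sub, map_smul (planeSum hI) Real.pi, planeSum_smul,
      planeSum_smul_complexCoords]
    rfl
  · filter_upwards [eventually_isBigO_one (isBigO_one_of_sub_isBigO hO)] with b hb
    rw [planarTeodorescu, ← planeSum_cauchyTransform hI hφ hb]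
    rfl

end CliffordValuedTransforms

section CauchyKernelDerivative

variable {m : ℕ} {I : Vec m} (hI : ‖I‖ = 1)

theorem hasFDerivAt_planeHom_inv_sub {z c : ℂ} (hz : z ≠ c) :
    HasFDerivAt (fun b => planeHom hI (z - b)⁻¹)
      (planeMulCLM hI (planeHom hI ((z - c) ^ 2)⁻¹)) c := by
  have hinv : HasDerivAt (fun b => (z - b)⁻¹) ((z - c) ^ 2)⁻¹ c := by
    simpa [neg_div] using ((hasDerivAt_id c).const_sub z).fun_inv (sub_ne_zero.2 hz)
  refine ((LinearMap.toContinuousLinearMap (planeHom hI).toLinearMap).hasFDerivAt.comp c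
    (hinv.hasFDerivAt.restrictScalars ℝ)).congr_fderiv (ContinuousLinearMap.ext fun v => ?_)
  exact map_mul (planeHom hI) v _

/-- The Fréchet derivative of `p ↦ S⁻¹(p, u + I v)` at `q`, for `z = u + i v` off the two singular
points. -/
def cauchyKernelFDeriv (q : Para m) (z : ℂ) : Para m →L[ℝ] Cl m :=
  sliceExtFDeriv I (fun b => planeHom hI (z - b)⁻¹)
    (planeMulCLM hI (planeHom hI ((z - planeCoord q) ^ 2)⁻¹))
    (planeMulCLM hI (planeHom hI ((z - star (planeCoord q)) ^ 2)⁻¹)) q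

theorem eventually_mem_nonreal {q : Para m} (hq : q ∈ nonreal m) : ∀ᶠ p in 𝓝 q, p ∈ nonreal m :=
  (vecCLM m).continuous.continuousAt.eventually_ne hq

theorem hasFDerivAt_cauchyKernel {q : Para m} (hq : q ∈ nonreal m) {z : ℂ}
    (hz : z ≠ planeCoord q) (hz' : z ≠ star (planeCoord q)) :
    HasFDerivAt (fun p => cauchyKernel p (slicePt I z)) (cauchyKernelFDeriv hI q z) q := by
  refine (hasFDerivAt_sliceExt hq (hasFDerivAt_planeHom_inv_sub hI hz)
    (hasFDerivAt_planeHom_inv_sub hI hz')).congr_of_eventuallyEq ?_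
  have hcont : ContinuousAt planeCoord q := (hasFDerivAt_planeCoord hq).continuousAt
  filter_upwards [eventually_mem_nonreal hq, hcont.eventually_ne hz.symm,
    hcont.star.eventually_ne hz'.symm] with p hp hpz hpz'
  exact cauchyKernel_slicePt_eq_sliceExt hI hp hpz.symm hpz'.symm

theorem kernelPartial_eq {q : Para m} (hq : q ∈ nonreal m) (j : Fin (m + 1)) {z : ℂ}
    (hz : z ≠ planeCoord q) (hz' : z ≠ star (planeCoord q)) :
    kernelPartial j q (slicePt I z) = cauchyKernelFDeriv hI q z (EuclideanSpace.single j 1) :=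
  ((hasFDerivAt_cauchyKernel hI hq hz hz').hasLineDerivAt _).lineDeriv

theorem kernelRadial_eq {q : Para m} (hq : q ∈ nonreal m) {z : ℂ}
    (hz : z ≠ planeCoord q) (hz' : z ≠ star (planeCoord q)) :
    kernelRadial q (slicePt I z) = cauchyKernelFDeriv hI q z (slicePt (unitVec q) Complex.I) :=
  (hasRadialDeriv_of_hasFDerivAt hq (hasFDerivAt_cauchyKernel hI hq hz hz')).deriv

end CauchyKernelDerivative

section PrincipalValue

variable {m : ℕ} {U : Set ℂ} {c : ℂ} {g h : ℂ → Cl m} {P Q : Cl m}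

theorem HasPV.congr (hU : MeasurableSet U) (hg : HasPV U c g P)
    (hgh : ∀ z, z ≠ c → z ≠ star c → h z = g z) : HasPV U c h P := by
  have hmeas (ε : ℝ) : MeasurableSet (U \ (ball c ε ∪ ball (star c) ε)) :=
    hU.diff (measurableSet_ball.union measurableSet_ball)
  have heq {ε : ℝ} (hε : 0 < ε) : Set.EqOn g h (U \ (ball c ε ∪ ball (star c) ε)) := by
    refine fun z hz => (hgh z ?_ ?_).symm <;> rintro rfl
    exacts [hz.2 (.inl (mem_ball_self hε)), hz.2 (.inr (mem_ball_self hε))]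
  refine ⟨fun ε hε => (hg.1 ε hε).congr_fun (heq hε) (hmeas ε), hg.2.congr' ?_⟩
  filter_upwards [self_mem_nhdsWithin] with ε hε
  exact setIntegral_congr_fun (hmeas ε) (heq hε)

theorem HasPV.add (hg : HasPV U c g P) (hh : HasPV U c h Q) :
    HasPV U c (fun z => g z + h z) (P + Q) := by
  refine ⟨fun ε hε => (hg.1 ε hε).add (hh.1 ε hε), (hg.2.add hh.2).congr' ?_⟩
  filter_upwards [self_mem_nhdsWithin] with ε hε
  exact (integral_add (hg.1 ε hε) (hh.1 ε hε)).symm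

theorem HasPV.map (L : Cl m →L[ℝ] Cl m) (hg : HasPV U c g P) :
    HasPV U c (fun z => L (g z)) (L P) := by
  refine ⟨fun ε hε => L.integrable_comp (hg.1 ε hε), ((L.continuous.tendsto P).comp hg.2).congr' ?_⟩
  filter_upwards [self_mem_nhdsWithin] with ε hε
  exact (L.integral_comp_comm (hg.1 ε hε)).symm

theorem HasPV.const_mul (hg : HasPV U c g P) (a : Cl m) : HasPV U c (fun z => a * g z) (a * P) :=
  hg.map (mulCLM m a)

theorem HasPV.of_star (hg : HasPV U (star c) g P) : HasPV U c g P := by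
  simpa only [HasPV, star_star, Set.union_comm] using hg

theorem HasPV.of_indicator (hU : MeasurableSet U) (hg : HasPV Set.univ c (U.indicator g) P) :
    HasPV U c g P := by
  have hdiff (V : Set ℂ) : U \ V = (Set.univ \ V) ∩ U := by
    rw [← Set.compl_eq_univ_sdiff, Set.inter_comm, Set.sdiff_eq]
  have hint (V : Set ℂ) : ∫ z in U \ V, g z = ∫ z in Set.univ \ V, U.indicator g z := by
    rw [hdiff, setIntegral_indicator hU]
  refine ⟨fun ε hε => ?_, by simpa only [hint] using hg.2⟩
  rw [hdiff, Set.inter_comm]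
  exact (integrableOn_indicator_iff hU).1 (hg.1 ε hε)

theorem hasPV_of_tendsto_ball (hc : star c ≠ c) (hg : ∀ ε > 0, IntegrableOn g (ball c ε)ᶜ)
    (hP : Tendsto (fun ε => ∫ z in (ball c ε)ᶜ, g z) (𝓝[>] 0) (𝓝 P)) :
    HasPV Set.univ c g P := by
  simp only [HasPV, ← Set.compl_eq_univ_sdiff]
  exact ⟨fun ε hε => (hg ε hε).mono_set (Set.compl_subset_compl.2 Set.subset_union_left),
    tendsto_setIntegral_compl_ball_union hc.symm hg hP⟩

theorem hasPV_integral (hc : star c ≠ c) (hg : Integrable g) :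
    HasPV Set.univ c g (∫ z, g z) := by
  refine hasPV_of_tendsto_ball hc (fun _ _ => hg.integrableOn) ?_
  have hlim := (tendsto_setIntegral_ball (c := c) one_pos hg.integrableOn).const_sub (∫ z, g z)
  simpa only [← setIntegral_compl measurableSet_ball hg, sub_zero] using hlim

variable {I : Vec m} (hI : ‖I‖ = 1) {φ : ℂ → Cl m}

theorem hasPV_clBeurlingTransform (hc : star c ≠ c) (hφ : Integrable φ)
    (hO : (fun z => φ z - φ c) =O[𝓝 c] fun z => z - c) :
    HasPV Set.univ c (fun z => planeHom hI ((z - c) ^ 2)⁻¹ * φ z) (clBeurlingTransform hI φ c) := by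
  have hint {ε : ℝ} (hε : 0 < ε) :=
    integrableOn_inv_sub_sq_smul (integrable_complexCoords hφ) c hε
  have hlim := ((planeSum hI).continuous.tendsto _).comp (tendsto_setIntegral_inv_sq_smul
    (integrable_complexCoords hφ) (isBigO_complexCoords_sub hO))
  simp only [← planeSum_smul_complexCoords hI]
  refine hasPV_of_tendsto_ball hc (fun ε hε => (planeSum hI).integrable_comp (hint hε))
    (hlim.congr' ?_)
  filter_upwards [self_mem_nhdsWithin] with ε hε
  exact ((planeSum hI).integral_comp_comm (hint hε)).symm

/-- The principal value of the integral over `ℂ_I` of `∂S⁻¹(q, x) φ(x)`, where `∂` is the derivative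
in `q` along a given direction. The kernel is the slice extension of `c ↦ (x - c)⁻¹`, and only the
derivatives along the planes produce a singular integral. -/
def cauchyKernelFDerivPV (φ : ℂ → Cl m) (q : Para m) : Para m →L[ℝ] Cl m :=
  sliceExtFDeriv I (clCauchyTransform hI φ)
    (planeMulCLM hI (clBeurlingTransform hI φ (planeCoord q)))
    (planeMulCLM hI (clBeurlingTransform hI φ (star (planeCoord q)))) q

theorem hasPV_cauchyKernelFDeriv_mul {q : Para m} (hq : q ∈ nonreal m) (hφ : Integrable φ)
    (hO : (fun z => φ z - φ (planeCoord q)) =O[𝓝 (planeCoord q)] fun z => z - planeCoord q)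
    (hO' : (fun z => φ z - φ (star (planeCoord q))) =O[𝓝 (star (planeCoord q))]
      fun z => z - star (planeCoord q)) (v : Para m) :
    HasPV Set.univ (planeCoord q) (fun z => cauchyKernelFDeriv hI q z v * φ z)
      (cauchyKernelFDerivPV hI φ q v) := by
  have hc : star (planeCoord q) ≠ planeCoord q := star_planeCoord_ne hq
  have hint := integrable_planeHom_inv_sub_mul hI hφ (isBigO_one_of_sub_isBigO hO)
  have hint' := integrable_planeHom_inv_sub_mul hI hφ (isBigO_one_of_sub_isBigO hO')
  have hα := ((hasPV_clBeurlingTransform hI hc hφ hO).const_mul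
    (planeHom hI (planeCoordFDeriv q v))).const_mul (alpha I q)
  have hβ := ((hasPV_clBeurlingTransform hI (by rwa [star_star, ne_comm]) hφ hO').of_star.const_mul
    (planeHom hI (star (planeCoordFDeriv q v)))).const_mul (beta I q)
  have hJ := (hasPV_integral hc (hint'.sub hint)).map ((mulCLM m (vecCl (unitVecFDeriv q v))).comp
    ((1 / 2 : ℝ) • mulCLM m (vecCl I)))
  rw [integral_sub' hint' hint] at hJ
  refine ((hα.add hβ).add hJ).congr .univ fun z _ _ => ?_
  simp only [cauchyKernelFDeriv, sliceExtFDeriv_apply, planeMulCLM_apply, add_mul, mul_assoc,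
    smul_mul_assoc, sub_mul]
  rfl

end PrincipalValue

section SliceTeodorescu

variable {m : ℕ} {I : Vec m} (hI : ‖I‖ = 1) {φ : ℂ → Cl m} {q : Para m}

theorem smul_sliceExt (r : ℝ) (g : ℂ → Cl m) :
    r • sliceExt I g q = sliceExt I (fun c => r • g c) q := by
  simp only [sliceExt, smul_add, mul_smul_comm]

section KernelIntegral

variable (hq : q ∈ nonreal m) (hφ : Integrable φ) (hb : φ =O[𝓝 (planeCoord q)] fun _ => (1 : ℝ))
  (hb' : φ =O[𝓝 (star (planeCoord q))] fun _ => (1 : ℝ))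
include hI hq

theorem cauchyKernel_mul_ae_eq : (fun z => cauchyKernel q (slicePt I z) * φ z) =ᵐ[volume]
    fun z => alpha I q * (planeHom hI (z - planeCoord q)⁻¹ * φ z) +
      beta I q * (planeHom hI (z - star (planeCoord q))⁻¹ * φ z) := by
  filter_upwards [Measure.ae_ne volume (planeCoord q),
    Measure.ae_ne volume (star (planeCoord q))] with z hz hz'
  rw [cauchyKernel_slicePt_eq_sliceExt hI hq hz hz', sliceExt, add_mul, mul_assoc, mul_assoc]

include hφ hb hb'

theorem integrable_cauchyKernel_mul :
    Integrable fun z => cauchyKernel q (slicePt I z) * φ z := by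
  refine Integrable.congr ?_ (cauchyKernel_mul_ae_eq hI hq).symm
  exact ((mulCLM m (alpha I q)).integrable_comp (integrable_planeHom_inv_sub_mul hI hφ hb)).add
    ((mulCLM m (beta I q)).integrable_comp (integrable_planeHom_inv_sub_mul hI hφ hb'))

theorem integral_cauchyKernel_mul :
    ∫ z, cauchyKernel q (slicePt I z) * φ z = sliceExt I (clCauchyTransform hI φ) q := by
  have hint := integrable_planeHom_inv_sub_mul hI hφ hb
  have hint' := integrable_planeHom_inv_sub_mul hI hφ hb'
  rw [integral_congr_ae (cauchyKernel_mul_ae_eq hI hq)]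
  refine (integral_add ((mulCLM m (alpha I q)).integrable_comp hint)
    ((mulCLM m (beta I q)).integrable_comp hint')).trans ?_
  rw [(mulCLM m (alpha I q)).integral_comp_comm hint,
    (mulCLM m (beta I q)).integral_comp_comm hint']
  rfl

end KernelIntegral

/-- The Fréchet derivative of the slice extension of the Teodorescu transform on `ℂ_I`. -/
def sliceTeodorescuFDeriv (φ : ℂ → Cl m) (q : Para m) : Para m →L[ℝ] Cl m :=
  sliceExtFDeriv I (planarTeodorescu hI φ) (planarTeodorescuFDeriv hI φ (planeCoord q))
    (planarTeodorescuFDeriv hI φ (star (planeCoord q))) q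

theorem two_pi_smul_sliceTeodorescuFDeriv (φ : ℂ → Cl m) (q v : Para m) :
    (2 * Real.pi) • sliceTeodorescuFDeriv hI φ q v = -cauchyKernelFDerivPV hI φ q v +
      Real.pi • (alpha I q * (planeHom hI (star (planeCoordFDeriv q v)) * φ (planeCoord q)) +
        beta I q * (planeHom hI (planeCoordFDeriv q v) * φ (star (planeCoord q)))) := by
  have hpi : Real.pi ≠ 0 := Real.pi_ne_zero
  simp only [sliceTeodorescuFDeriv, cauchyKernelFDerivPV, sliceExtFDeriv_apply,
    planarTeodorescuFDeriv_apply, planarTeodorescu, planeMulCLM_apply, star_star, mul_sub,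
    mul_smul_comm]
  match_scalars <;> field_simp

theorem two_pi_smul_sliceTeodorescuFDeriv_of_eq_one (φ : ℂ → Cl m) {v : Para m}
    (hv : planeCoordFDeriv q v = 1) :
    (2 * Real.pi) • sliceTeodorescuFDeriv hI φ q v = -cauchyKernelFDerivPV hI φ q v +
      Real.pi • (alpha I q * φ (planeCoord q) + beta I q * φ (star (planeCoord q))) := by
  rw [two_pi_smul_sliceTeodorescuFDeriv, hv, star_one, map_one, one_mul, one_mul]

theorem two_pi_smul_sliceTeodorescuFDeriv_of_eq_smul_I (φ : ℂ → Cl m) {v : Para m} {r : ℝ}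
    (hv : planeCoordFDeriv q v = r • Complex.I) :
    (2 * Real.pi) • sliceTeodorescuFDeriv hI φ q v = -cauchyKernelFDerivPV hI φ q v -
      r • Real.pi • (alpha I q * vecCl I * φ (planeCoord q) -
        beta I q * vecCl I * φ (star (planeCoord q))) := by
  have hstar : star (r • Complex.I) = -(r • Complex.I) := by
    rw [star_smul, star_trivial, Complex.star_def, Complex.conj_I, smul_neg]
  rw [two_pi_smul_sliceTeodorescuFDeriv, hv, hstar, map_neg, map_smul, planeHom_I]
  simp only [neg_mul, mul_neg, smul_mul_assoc, mul_smul_comm, mul_assoc]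
  module

end SliceTeodorescu

section AxialSet

variable {m : ℕ} {D : Set ℂ} (hconj : ∀ z ∈ D, star z ∈ D) {I : Vec m}

theorem slicePt_mem_axialSet (hI : ‖I‖ = 1) {z : ℂ} (hz : z ∈ D) : slicePt I z ∈ axialSet m D :=
  Set.mem_biUnion (mem_sphere_zero_iff_norm.2 hI) ⟨z, hz, rfl⟩

theorem planeCoord_slicePt (hI : ‖I‖ = 1) (z : ℂ) :
    planeCoord (slicePt I z) = z ∨ planeCoord (slicePt I z) = star z := by
  have hnorm : ‖vec (slicePt I z)‖ = |z.im| := by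
    change ‖z.im • I‖ = _
    rw [norm_smul, hI, mul_one, Real.norm_eq_abs]
  exact (abs_choice z.im).imp (fun him => Complex.ext rfl (hnorm.trans him))
    fun him => Complex.ext rfl (hnorm.trans him)

include hconj

theorem planeCoord_mem_of_mem_axialSet {q : Para m} (hq : q ∈ axialSet m D) :
    planeCoord q ∈ D := by
  simp only [axialSet, Set.mem_iUnion] at hq
  obtain ⟨J, hJ, z, hz, rfl⟩ := hq
  rcases planeCoord_slicePt (mem_sphere_zero_iff_norm.1 hJ) z with h | h <;> rw [h]
  exacts [hz, hconj z hz]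

theorem planeSet_axialSet (hI : ‖I‖ = 1) : planeSet (axialSet m D) I = D := by
  refine Set.Subset.antisymm (fun z hz => ?_) fun z hz => slicePt_mem_axialSet hI hz
  have hmem := planeCoord_mem_of_mem_axialSet hconj hz
  rcases planeCoord_slicePt hI z with h | h <;> rw [h] at hmem
  exacts [hmem, star_star z ▸ hconj _ hmem]

end AxialSet

section C1Closure

variable {m : ℕ} {D : Set ℂ} {I : Vec m} {f : Para m → Cl m}

theorem isBounded_of_isBounded_axialSet (hI : ‖I‖ = 1)
    (hbdd : Bornology.IsBounded (axialSet m D)) : Bornology.IsBounded D := by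
  obtain ⟨C, hC⟩ := isBounded_iff_forall_norm_le.1 hbdd
  exact isBounded_iff_forall_norm_le.2
    ⟨C, fun z hz => norm_slicePt hI z ▸ hC _ (slicePt_mem_axialSet hI hz)⟩

/-- `slicePt J` as a continuous linear map. -/
def slicePtCLM (J : Vec m) : ℂ →L[ℝ] Para m :=
  LinearMap.toContinuousLinearMap
    { toFun := slicePt J
      map_add' := fun z w => by
        ext i
        refine Fin.cases rfl (fun j => ?_) i
        exact add_mul z.im w.im (J j)
      map_smul' := fun r z => by
        ext i
        refine Fin.cases ?_ (fun j => ?_) i <;> simp [slicePt, mul_assoc] }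

theorem IsC1Closure.differentiableAt_comp_slicePt (hf : IsC1Closure (axialSet m D) f)
    (hI : ‖I‖ = 1) {c : ℂ} (hc : c ∈ D) : DifferentiableAt ℝ (fun z => f (slicePt I z)) c := by
  obtain ⟨g, g', -, -, hfg⟩ := hf
  exact (hfg _ (slicePt_mem_axialSet hI hc)).2.differentiableAt.comp c
    (slicePtCLM I).differentiableAt

theorem IsC1Closure.integrableOn_comp_slicePt (hf : IsC1Closure (axialSet m D) f)
    (hD : IsOpen D) (hbdd : Bornology.IsBounded (axialSet m D)) (hI : ‖I‖ = 1) :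
    IntegrableOn (fun z => f (slicePt I z)) D := by
  have hcont : ContinuousOn (fun z => f (slicePt I z)) D := fun c hc =>
    (hf.differentiableAt_comp_slicePt hI hc).continuousAt.continuousWithinAt
  obtain ⟨g, g', hg, -, hfg⟩ := hf
  obtain ⟨M, hM⟩ := hbdd.isCompact_closure.exists_bound_of_continuousOn hg
  refine IntegrableOn.of_bound (isBounded_of_isBounded_axialSet hI hbdd).measure_lt_top
    (hcont.aestronglyMeasurable hD.measurableSet) M ?_
  filter_upwards [ae_restrict_mem hD.measurableSet] with z hz
  have hmem := slicePt_mem_axialSet hI hz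
  exact (hfg _ hmem).1 ▸ hM _ (subset_closure hmem)

end C1Closure

section SliceTransform

/-- The restriction of `f` to `Ω_I` in the coordinate of `ℂ_I`, extended by `0`. -/
def planeRestrict {m : ℕ} (D : Set ℂ) (I : Vec m) (f : Para m → Cl m) : ℂ → Cl m :=
  D.indicator fun z => f (slicePt I z)

variable {m : ℕ} {D : Set ℂ} {I : Vec m} {f : Para m → Cl m} {c : ℂ} {q : Para m}

theorem planeRestrict_of_mem (hc : c ∈ D) : planeRestrict D I f c = f (slicePt I c) :=
  Set.indicator_of_mem hc _

theorem integrable_planeRestrict (hD : MeasurableSet D)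
    (hf : IntegrableOn (fun z => f (slicePt I z)) D) : Integrable (planeRestrict D I f) :=
  (integrable_indicator_iff hD).2 hf

theorem isBigO_planeRestrict_sub (hD : IsOpen D) (hc : c ∈ D)
    (hO : (fun z => f (slicePt I z) - f (slicePt I c)) =O[𝓝 c] fun z => z - c) :
    (fun z => planeRestrict D I f z - planeRestrict D I f c) =O[𝓝 c] fun z => z - c := by
  refine hO.congr' ?_ .rfl
  filter_upwards [hD.mem_nhds hc] with z hz
  rw [planeRestrict_of_mem hz, planeRestrict_of_mem hc]

theorem indicator_mul_comp_slicePt (K : ℂ → Cl m) :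
    D.indicator (fun z => K z * f (slicePt I z)) = fun z => K z * planeRestrict D I f z :=
  funext fun _ => Set.indicator_mul_right D K fun z => f (slicePt I z)

variable (hD : IsOpen D) (hconj : ∀ z ∈ D, star z ∈ D) (hI : ‖I‖ = 1)
  (hf : IntegrableOn (fun z => f (slicePt I z)) D)
  (hO : ∀ c ∈ D, (fun z => f (slicePt I z) - f (slicePt I c)) =O[𝓝 c] fun z => z - c)
  (hq : q ∈ nonreal m) (hqD : planeCoord q ∈ D)
include hD hI hf hO

theorem hasFDerivAt_planarTeodorescu_planeRestrict (hc : c ∈ D) :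
    HasFDerivAt (planarTeodorescu hI (planeRestrict D I f))
      (planarTeodorescuFDeriv hI (planeRestrict D I f) c) c :=
  hasFDerivAt_planarTeodorescu hI (integrable_planeRestrict hD.measurableSet hf)
    (isBigO_planeRestrict_sub hD hc (hO c hc))

include hconj hq hqD

theorem integrableOn_cauchyKernel_mul :
    IntegrableOn (fun z => cauchyKernel q (slicePt I z) * f (slicePt I z)) D := by
  rw [← integrable_indicator_iff hD.measurableSet, indicator_mul_comp_slicePt]
  exact integrable_cauchyKernel_mul hI hq (integrable_planeRestrict hD.measurableSet hf)
    (isBigO_one_of_sub_isBigO (isBigO_planeRestrict_sub hD hqD (hO _ hqD)))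
    (isBigO_one_of_sub_isBigO (isBigO_planeRestrict_sub hD (hconj _ hqD) (hO _ (hconj _ hqD))))

theorem sliceT_eventuallyEq_sliceExt : sliceT (axialSet m D) I f =ᶠ[𝓝 q]
    sliceExt I (planarTeodorescu hI (planeRestrict D I f)) := by
  have hcont : ContinuousAt planeCoord q := (hasFDerivAt_planeCoord hq).continuousAt
  filter_upwards [eventually_mem_nonreal hq, hcont.eventually (hD.mem_nhds hqD)] with p hp hpD
  have hpD' := hconj _ hpD
  rw [sliceT, planeSet_axialSet hconj hI, ← integral_indicator hD.measurableSet,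
    indicator_mul_comp_slicePt, integral_cauchyKernel_mul hI hp
      (integrable_planeRestrict hD.measurableSet hf)
      (isBigO_one_of_sub_isBigO (isBigO_planeRestrict_sub hD hpD (hO _ hpD)))
      (isBigO_one_of_sub_isBigO (isBigO_planeRestrict_sub hD hpD' (hO _ hpD'))), smul_sliceExt]
  rfl

theorem hasFDerivAt_sliceT : HasFDerivAt (sliceT (axialSet m D) I f)
    (sliceTeodorescuFDeriv hI (planeRestrict D I f) q) q :=
  (hasFDerivAt_sliceExt hq (hasFDerivAt_planarTeodorescu_planeRestrict hD hI hf hO hqD)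
    (hasFDerivAt_planarTeodorescu_planeRestrict hD hI hf hO (hconj _ hqD))).congr_of_eventuallyEq
    (sliceT_eventuallyEq_sliceExt hD hconj hI hf hO hq hqD)

theorem hasPV_mul_of_eq_cauchyKernelFDeriv {K : ℂ → Cl m} {v : Para m}
    (hK : ∀ z, z ≠ planeCoord q → z ≠ star (planeCoord q) → K z = cauchyKernelFDeriv hI q z v) :
    HasPV D (planeCoord q) (fun z => K z * f (slicePt I z))
      (cauchyKernelFDerivPV hI (planeRestrict D I f) q v) := by
  have hqD' := hconj _ hqD
  refine .of_indicator hD.measurableSet ?_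
  rw [indicator_mul_comp_slicePt]
  refine (hasPV_cauchyKernelFDeriv_mul hI hq (integrable_planeRestrict hD.measurableSet hf)
    (isBigO_planeRestrict_sub hD hqD (hO _ hqD))
    (isBigO_planeRestrict_sub hD hqD' (hO _ hqD')) v).congr .univ fun z hz hz' => ?_
  rw [hK z hz hz']

theorem opG_sliceT :
    opG (sliceT (axialSet m D) I f) q = sliceExt I (fun z => f (slicePt I z)) q := by
  have hT := hasFDerivAt_planarTeodorescu_planeRestrict hD hI hf hO hqD
  have hT' := hasFDerivAt_planarTeodorescu_planeRestrict hD hI hf hO (hconj _ hqD)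
  rw [opG_eq_of_hasFDerivAt hq (hasFDerivAt_sliceT hD hconj hI hf hO hq hqD),
    sliceTeodorescuFDeriv, ← opG_eq_of_hasFDerivAt hq (hasFDerivAt_sliceExt hq hT hT'),
    opG_sliceExt hq hT hT' hI, planarTeodorescuFDeriv_one_add, planarTeodorescuFDeriv_one_add,
    planeRestrict_of_mem hqD, planeRestrict_of_mem (hconj _ hqD), sliceExt]

end SliceTransform

theorem mainTheorem2_general {m : ℕ} {D : Set ℂ} (hD : IsOpen D) (hconj : ∀ z ∈ D, star z ∈ D)
    {f : Para m → Cl m} {I : Vec m} (hI : ‖I‖ = 1)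
    (hf : IntegrableOn (fun z => f (slicePt I z)) D)
    (hO : ∀ c ∈ D, (fun z => f (slicePt I z) - f (slicePt I c)) =O[𝓝 c] fun z => z - c) :
    (∀ q ∈ axialSet m D ∩ nonreal m,
      IntegrableOn (fun z => cauchyKernel q (slicePt I z) * f (slicePt I z))
        (planeSet (axialSet m D) I) ∧
      (∃ P T' : Cl m,
        HasPV (planeSet (axialSet m D) I) (planeCoord q)
          (fun z => kernelPartial 0 q (slicePt I z) * f (slicePt I z)) P ∧
        HasLineDerivAt ℝ (sliceT (axialSet m D) I f) T' q (EuclideanSpace.single 0 1) ∧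
        (2 * Real.pi) • T' = -P + Real.pi • (alpha I q * f (slicePt I (planeCoord q)) +
          beta I q * f (slicePt I (star (planeCoord q))))) ∧
      (∀ i : Fin m, ∃ P T' : Cl m,
        HasPV (planeSet (axialSet m D) I) (planeCoord q)
          (fun z => kernelPartial i.succ q (slicePt I z) * f (slicePt I z)) P ∧
        HasLineDerivAt ℝ (sliceT (axialSet m D) I f) T' q (EuclideanSpace.single i.succ 1) ∧
        (2 * Real.pi) • T' = -P - (q i.succ / ‖vec q‖) • Real.pi •
          (alpha I q * vecCl I * f (slicePt I (planeCoord q)) -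
            beta I q * vecCl I * f (slicePt I (star (planeCoord q))))) ∧
      (∃ P T' : Cl m,
        HasPV (planeSet (axialSet m D) I) (planeCoord q)
          (fun z => kernelRadial q (slicePt I z) * f (slicePt I z)) P ∧
        HasRadialDeriv (sliceT (axialSet m D) I f) T' q ∧
        (2 * Real.pi) • T' = -P - Real.pi •
          (alpha I q * vecCl I * f (slicePt I (planeCoord q)) -
            beta I q * vecCl I * f (slicePt I (star (planeCoord q))))) ∧
      opG (sliceT (axialSet m D) I f) q = alpha I q * f (slicePt I (planeCoord q)) +
        beta I q * f (slicePt I (star (planeCoord q)))) ∧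
    (IsSlice D f → ∀ q ∈ axialSet m D ∩ nonreal m,
      opG (sliceT (axialSet m D) I f) q = f q) := by
  refine (and_iff_left_of_imp fun main hfs q hq => (main q hq).2.2.2.2.trans
    (hfs.sliceExt_eq hconj hI hq.2 (planeCoord_mem_of_mem_axialSet hconj hq.1))).2 ?_
  rintro q ⟨hqΩ, hq⟩
  have hqD := planeCoord_mem_of_mem_axialSet hconj hqΩ
  have hT := hasFDerivAt_sliceT hD hconj hI hf hO hq hqD
  have hPV {K : ℂ → Cl m} {v : Para m} :=
    hasPV_mul_of_eq_cauchyKernelFDeriv hD hconj hI hf hO hq hqD (K := K) (v := v)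
  rw [planeSet_axialSet hconj hI, ← planeRestrict_of_mem (I := I) (f := f) hqD,
    ← planeRestrict_of_mem (I := I) (f := f) (hconj _ hqD)]
  refine ⟨integrableOn_cauchyKernel_mul hD hconj hI hf hO hq hqD,
    ⟨_, _, hPV fun _ => kernelPartial_eq hI hq 0, hT.hasLineDerivAt _,
      two_pi_smul_sliceTeodorescuFDeriv_of_eq_one hI _ planeCoordFDeriv_single_zero⟩,
    fun i => ⟨_, _, hPV fun _ => kernelPartial_eq hI hq i.succ, hT.hasLineDerivAt _,
      two_pi_smul_sliceTeodorescuFDeriv_of_eq_smul_I hI _ (planeCoordFDeriv_single_succ i)⟩,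
    ⟨_, _, hPV fun _ => kernelRadial_eq hI hq, hasRadialDeriv_of_hasFDerivAt hq hT, ?_⟩, ?_⟩
  · rw [← one_smul ℝ (Real.pi • _)]
    exact two_pi_smul_sliceTeodorescuFDeriv_of_eq_smul_I hI _
      ((planeCoordFDeriv_slicePt_I hq).trans (one_smul ℝ Complex.I).symm)
  · rw [opG_sliceT hD hconj hI hf hO hq hqD, sliceExt, planeRestrict_of_mem hqD,
      planeRestrict_of_mem (hconj _ hqD)]

end SliceClifford

end

open SliceClifford

theorem mainTheorem2 (m : ℕ) (D : Set ℂ) (hD : IsOpen D) (hconj : ∀ z ∈ D, star z ∈ D)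
    (hbdd : Bornology.IsBounded (axialSet m D))
    (hreal : axialSet m D ⊆ nonreal m)
    (f : Para m → Cl m)
    (hf : IsC1Closure (axialSet m D) f)
    (I : Vec m) (hI : ‖I‖ = 1) :
    (∀ q ∈ axialSet m D,
      -- the integral which defines the transform converges absolutely
      MeasureTheory.IntegrableOn
        (fun z : ℂ => cauchyKernel q (slicePt I z) *
          f (slicePt I z))
        (planeSet (axialSet m D) I) ∧
      -- the derivative with respect to the real part of `q`
      (∃ P T' : Cl m,
        HasPV (planeSet (axialSet m D) I)
          (planeCoord q)
          (fun z => kernelPartial 0 q (slicePt I z) *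
            f (slicePt I z)) P ∧
        HasLineDerivAt ℝ (sliceT (axialSet m D) I f) T' q
          (EuclideanSpace.single 0 1) ∧
        (2 * Real.pi) • T' = -P + Real.pi •
          (alpha I q *
              f (slicePt I (planeCoord q)) +
            beta I q *
              f (slicePt I (star (planeCoord q))))) ∧
      -- the derivatives with respect to the other coordinates of `q`
      (∀ i : Fin m, ∃ P T' : Cl m,
        HasPV (planeSet (axialSet m D) I)
          (planeCoord q)
          (fun z => kernelPartial i.succ q (slicePt I z) *
            f (slicePt I z)) P ∧
        HasLineDerivAt ℝ (sliceT (axialSet m D) I f) T' q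
          (EuclideanSpace.single i.succ 1) ∧
        (2 * Real.pi) • T' = -P - (q i.succ / ‖vec q‖) • Real.pi •
          (alpha I q * vecCl I *
              f (slicePt I (planeCoord q)) -
            beta I q * vecCl I *
              f (slicePt I (star (planeCoord q))))) ∧
      -- the derivative with respect to the modulus of the vector part of `q`
      (∃ P T' : Cl m,
        HasPV (planeSet (axialSet m D) I)
          (planeCoord q)
          (fun z => kernelRadial q (slicePt I z) *
            f (slicePt I z)) P ∧
        HasRadialDeriv
          (sliceT (axialSet m D) I f) T' q ∧
        (2 * Real.pi) • T' = -P - Real.pi •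
          (alpha I q * vecCl I *
              f (slicePt I (planeCoord q)) -
            beta I q * vecCl I *
              f (slicePt I (star (planeCoord q))))) ∧
      opG (sliceT (axialSet m D) I f) q =
        alpha I q *
            f (slicePt I (planeCoord q)) +
          beta I q *
            f (slicePt I (star (planeCoord q)))) ∧
    (IsSlice D f → ∀ q ∈ axialSet m D,
      opG (sliceT (axialSet m D) I f) q = f q) := by
  have main := mainTheorem2_general hD hconj hI (hf.integrableOn_comp_slicePt hD hbdd hI)
    fun _ hc => (hf.differentiableAt_comp_slicePt hI hc).isBigO_sub
  exact ⟨fun q hq => main.1 q ⟨hq, hreal hq⟩, fun hfs q hq => main.2 hfs q ⟨hq, hreal hq⟩⟩
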